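/- There is an absolute constant $C$ such that the following holds for every $n$. Let $R_1,\dots,R_n$ be pairwise disjoint closed axis-aligned rectangles in the plane (a rectangle may degenerate to a horizontal or vertical segment or to a point), and let $S=\{P_1,\dots,P_n\}$, where the cluster $P_i$ is the set of all corners of $R_i$. Then the farthest-color Voronoi diagram of $S$ has combinatorial complexity at most $Cn$, i.e. $O(n)$. Here the distance from a point $t$ to a cluster $P$ is $d(t,P)=\min_{p\in P}|t-p|$. The region of a point $p\in P_i$ is the set of all $t\in\mathbb{R}^2$ such that $d(t,P_j)<d(t,P_i)$ for every $j\ne i$, and $|t-p|<|t-q|$ for every $q\in P_i\setminus\{p\}$; that is, the region where $P_i$ is the farthest cluster is further subdivided by the nearest-neighbor Voronoi diagram of $P_i$. The faces of the diagram are the connected components of the union of these regions (which are open and pairwise disjoint); its vertices are the points that lie in the closures of at least three regions; its edges (including the internal edges, which separate regions of two points of the same cluster) are the connected components of the union of the boundaries of all regions minus the vertices. The combinatorial complexity is the total number of vertices, edges and faces. -/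

import Mathlib

/-- The Euclidean plane. -/
abbrev Plane : Type := EuclideanSpace ℝ (Fin 2)

/-- A closed axis-aligned rectangle `[lo 0, hi 0] × [lo 1, hi 1]`; it may degenerate to a
horizontal or vertical segment, or to a single point. -/
structure AxisRect where
  lo : Plane
  hi : Plane
  le : ∀ k, lo k ≤ hi k

/-- The closed rectangle as a set of points. -/
def AxisRect.toSet (R : AxisRect) : Set Plane :=
  {x | ∀ k, R.lo k ≤ x k ∧ x k ≤ R.hi k}

/-- All the corners of the rectangle: four, two or one point. -/
def AxisRect.corners (R : AxisRect) : Set Plane :=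
  {x | ∀ k, x k = R.lo k ∨ x k = R.hi k}

/-- The set of connected components of a subset of the plane. -/
def components (A : Set Plane) : Set (Set Plane) :=
  {c | ∃ x ∈ A, c = connectedComponentIn A x}

namespace FCVD

variable {ι : Type} (P : ι → Set Plane)

/-- The region of the cluster `P i`: the points for which `P i` is the farthest cluster, where
the distance from a point to a (finite, nonempty) cluster is the minimum distance to a point
of the cluster. -/
def clusterRegion (i : ι) : Set Plane :=
  {x | ∀ j, j ≠ i → Metric.infDist x (P j) < Metric.infDist x (P i)}

/-- The cell of the point `p` in the nearest-neighbor Voronoi diagram of the point set `A`. -/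
def nearestCell (A : Set Plane) (p : Plane) : Set Plane :=
  {x | ∀ q ∈ A, q ≠ p → dist x p < dist x q}

/-- The region of a point `p` of the cluster `P i` (the pair `s = ⟨i, p⟩`): the region of `P i`
is subdivided by the nearest-neighbor Voronoi diagram of `P i`. -/
def region (s : Σ i, P i) : Set Plane :=
  clusterRegion P s.1 ∩ nearestCell (P s.1) s.2

/-- The faces of the diagram: the connected components of the regions. (The regions are open
and pairwise disjoint.) -/
def faces : Set (Set Plane) :=
  components (⋃ s, region P s)

/-- The point set covered by the vertices and edges of the diagram, internal edges included:
the union of the boundaries of the regions. -/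
def skeleton : Set Plane :=
  ⋃ s, frontier (region P s)

/-- The vertices of the diagram: the points where at least three regions meet. -/
def vertices : Set Plane :=
  {x | 3 ≤ {s : Σ i, P i | x ∈ closure (region P s)}.encard}

/-- The edges of the diagram (internal ones included, bounded and unbounded): the connected
components of the skeleton after removal of the vertices. -/
def edges : Set (Set Plane) :=
  components (skeleton P \ vertices P)

/-- The combinatorial complexity: the total number of vertices, edges and faces. It is an
extended natural number, so that a finite bound includes finiteness. -/
noncomputable def complexity : ℕ∞ :=
  (vertices P).encard + (edges P).encard + (faces P).encard

end FCVD

/-!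
The proof bounds the diagram by decomposing it into `O(n)` convex cells.

**Convex subdivisions** (`ConvexSubdivision`). Let finitely many disjoint open convex cells cover
the plane up to finitely many lines, and fix a direction parallel to none of these lines, called
horizontal. At a point in the closure of three cells, at most one cell contains a short horizontal
segment to the left of the point and at most one to its right; a third cell lies strictly above or
strictly below, and the point is its unique lowest or highest point. So `M` cells have at most `2M`
such points (`encard_multi_le`). Two cells that are horizontal neighbours stay so along a segment;
going down, this stops because one of the two cells ends, or at a point in three closures, and
either event determines the pair. So there are `O(M)` pairs of neighbours (`encard_adjPairs_le`).
When every region of the Voronoi diagram is a union of cells up to boundaries, vertices, edges and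
faces are charged to these objects (`FCVD.Refines.complexity_le`), and no Euler formula is needed.

**Regions.** Let `p` be a corner of `R i` and put `f q z = 2⟪q - p, z⟫ / |q - p|²`
(`bisectorFun`), so that `p + z` is nearer to `q` than to `p` exactly if `f q z > 1`. The region of
`p` is the set of `p + z` with `H z < 1 < G z`, where `H` is the maximum of `f q` over the other
corners `q` of `R i`, and `G` is the minimum over `j ≠ i` of the maximum of `f q` over the corners
of `R j`. Take two points of the region in the same open quadrant at `p`. On the segment between
them `G` is positive, because in a fixed quadrant one corner of `R j` always maximizes `f`. If the
segment leaves the region, then for some `z` on it one of the following happens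
(`exists_tight_of_not_forall`): either `G z = H z`, and then `w = p + z / G z` has two nearest
corners in `R i` and `R i` is a farthest rectangle tied with another one; or `G` has its last
minimum at `z`, and then at `w` every farthest rectangle other than `R i` has two nearest corners,
since a unique one would make `G` constant further along. Hence the directions from `p` to these
points `w` (`tieSet`, `cutSet`) cut the region into convex sectors (`sectorCell`).

**Counting.** A point of `tieSet R j` lies on a line halfway between two opposite sides of `R j`.
Squared distances to the corners are sums of one-variable functions, and two disjoint rectangles
are separated in one coordinate. Along the halfway line, a rectangle separated in the direction of
the line is compared monotonically with `R j`. One separated across the line is strictly farther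
than `R j` at the height of each side, and on each half of the line the comparison function is
concave. So a halfway line carries at most six points (`encard_tieLine_le`). Every point of a
`cutSet` belongs to some `tieSet` and determines its corner `p` (`eq_of_mem_cutSet`), so there are
`O(n)` cutting directions in all and `O(n)` cells (`card_cellIndex_le`).
-/

open Set Filter Topology

/-! ### Subdivisions of the plane into convex cells -/

/-- Disjoint open convex cells that cover every line of direction `dir` up to finitely many points.
The linear form `height` has the line spanned by `dir` as its kernel, so that lines of direction
`dir` are the horizontal lines. -/
structure ConvexSubdivision (κ E : Type*) [NormedAddCommGroup E] [NormedSpace ℝ E] where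
  cell : κ → Set E
  isOpen : ∀ k, IsOpen (cell k)
  convex : ∀ k, Convex ℝ (cell k)
  eq_of_mem : ∀ {k k' x}, x ∈ cell k → x ∈ cell k' → k = k'
  dir : E
  height : E →L[ℝ] ℝ
  height_dir : height dir = 0
  exists_smul : ∀ x, height x = 0 → ∃ t : ℝ, x = t • dir
  finite_compl : ∀ x, {t : ℝ | ∀ k, x + t • dir ∉ cell k}.Finite

namespace ConvexSubdivision

variable {κ E : Type*} [NormedAddCommGroup E] [NormedSpace ℝ E] (T : ConvexSubdivision κ E)

/-- The mirror image: left and right are exchanged. -/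
def flip : ConvexSubdivision κ E where
  cell := T.cell
  isOpen := T.isOpen
  convex := T.convex
  eq_of_mem := T.eq_of_mem
  dir := -T.dir
  height := T.height
  height_dir := by simp [T.height_dir]
  exists_smul x hx := by
    obtain ⟨t, rfl⟩ := T.exists_smul x hx
    exact ⟨-t, by simp⟩
  finite_compl x := by
    have h := (T.finite_compl x).image (fun t => -t)
    refine h.subset fun t ht => ⟨-t, ?_, by simp⟩
    simpa using ht

/-- The cell `k` contains a short open horizontal segment with left endpoint `x`. -/
def Right (x : E) (k : κ) : Prop := ∀ᶠ ε : ℝ in 𝓝[>] 0, x + ε • T.dir ∈ T.cell k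

/-- The cell `k` contains a short open horizontal segment with right endpoint `x`. -/
def Left (x : E) (k : κ) : Prop := ∀ᶠ ε : ℝ in 𝓝[>] 0, x - ε • T.dir ∈ T.cell k

lemma flip_right {x : E} {k : κ} : T.flip.Right x k ↔ T.Left x k := by
  simp [Right, Left, flip, sub_eq_add_neg]

lemma flip_left {x : E} {k : κ} : T.flip.Left x k ↔ T.Right x k := by
  simp [Right, Left, flip, sub_eq_add_neg]

lemma eventually_mem (x : E) : ∀ᶠ ε : ℝ in 𝓝[>] 0, ∃ k, x + ε • T.dir ∈ T.cell k := by
  have h := (T.finite_compl x).subset (sdiff_subset (t := {0}))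
  have h1 : ({t : ℝ | ∀ k, x + t • T.dir ∉ T.cell k} \ {0})ᶜ ∈ 𝓝 (0:ℝ) :=
    h.isClosed.isOpen_compl.mem_nhds (by simp)
  filter_upwards [mem_nhdsWithin_of_mem_nhds h1, self_mem_nhdsWithin] with ε h2 h3
  by_contra! h4
  exact h2 ⟨h4, ne_of_gt h3⟩

lemma exists_right [Finite κ] (x : E) : ∃ k, T.Right x k := by
  -- some cell meets every short segment; as it is convex, it contains a short segment
  have h : ∃ k, ∃ᶠ ε : ℝ in 𝓝[>] 0, x + ε • T.dir ∈ T.cell k := by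
    by_contra! h
    have h1 : ∀ᶠ ε : ℝ in 𝓝[>] 0, ∀ k, x + ε • T.dir ∉ T.cell k :=
      eventually_all.2 fun k => by simpa using h k
    obtain ⟨ε, h2, k, h3⟩ := (h1.and (T.eventually_mem x)).exists
    exact h2 k h3
  obtain ⟨k, hk⟩ := h
  refine ⟨k, ?_⟩
  obtain ⟨ε₁, h1, h1pos⟩ := (hk.and_eventually self_mem_nhdsWithin).exists
  have h1pos : 0 < ε₁ := h1pos
  filter_upwards [Ioo_mem_nhdsGT h1pos] with ε hε
  obtain ⟨ε₂, h2, h2pos, h2lt⟩ := (hk.and_eventually (Ioo_mem_nhdsGT hε.1)).exists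
  refine (T.convex k).segment_subset h2 h1 ?_
  refine ⟨(ε₁ - ε) / (ε₁ - ε₂), (ε - ε₂) / (ε₁ - ε₂), ?_, ?_, ?_, ?_⟩
  · exact div_nonneg (by linarith [hε.2]) (by linarith [hε.2])
  · exact div_nonneg (by linarith [hε.2]) (by linarith [hε.2])
  · have : ε₁ - ε₂ ≠ 0 := by linarith [hε.2]
    field_simp; ring
  · have : ε₁ - ε₂ ≠ 0 := by linarith [hε.2]
    match_scalars <;> field_simp <;> ring

lemma exists_left [Finite κ] (x : E) : ∃ k, T.Left x k := by
  simpa only [flip_right] using T.flip.exists_right x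

variable {T} {x y z : E} {k k' k₁ k₂ : κ}

lemma Right.unique (h : T.Right x k) (h' : T.Right x k') : k = k' := by
  obtain ⟨ε, h1, h2⟩ := (h.and h').exists
  exact T.eq_of_mem h1 h2

lemma Left.unique (h : T.Left x k) (h' : T.Left x k') : k = k' :=
  (T.flip_right.2 h).unique (T.flip_right.2 h')

lemma Right.mem_closure (h : T.Right x k) : x ∈ closure (T.cell k) := by
  have : Tendsto (fun ε : ℝ => x + ε • T.dir) (𝓝[>] 0) (𝓝 x) := by
    have : Tendsto (fun ε : ℝ => x + ε • T.dir) (𝓝 0) (𝓝 (x + (0:ℝ) • T.dir)) :=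
      Continuous.tendsto (by fun_prop) 0
    simpa using this.mono_left nhdsWithin_le_nhds
  exact mem_closure_of_tendsto this h

lemma Left.mem_closure (h : T.Left x k) : x ∈ closure (T.cell k) :=
  (T.flip_right.2 h).mem_closure

lemma eq_of_mem_closure (h : x ∈ T.cell k) (h' : x ∈ closure (T.cell k')) : k = k' := by
  obtain ⟨y, h1, h2⟩ := mem_closure_iff.1 h' _ (T.isOpen k) h
  exact T.eq_of_mem h1 h2

lemma openSegment_mem (hx : x ∈ closure (T.cell k)) (hy : y ∈ T.cell k) :
    openSegment ℝ x y ⊆ T.cell k := by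
  have h := (T.convex k).openSegment_closure_interior_subset_interior hx
    (by rwa [(T.isOpen k).interior_eq])
  rwa [(T.isOpen k).interior_eq] at h

lemma right_of_mem {t : ℝ} (hx : x ∈ closure (T.cell k)) (ht : 0 < t)
    (h : x + t • T.dir ∈ T.cell k) : T.Right x k := by
  filter_upwards [Ioo_mem_nhdsGT ht] with ε hε
  refine openSegment_mem hx h ⟨1 - ε / t, ε / t, ?_, div_pos hε.1 ht, by ring, ?_⟩
  · have := (div_lt_one ht).2 hε.2
    linarith
  · match_scalars <;> field_simp <;> ring

lemma left_of_mem {t : ℝ} (hx : x ∈ closure (T.cell k)) (ht : 0 < t)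
    (h : x - t • T.dir ∈ T.cell k) : T.Left x k := by
  rw [← flip_right]
  exact right_of_mem (T := T.flip) hx ht (by simpa [flip, sub_eq_add_neg] using h)

lemma mem_of_left_right (h : T.Left x k) (h' : T.Right x k) : x ∈ T.cell k := by
  obtain ⟨ε, h1, h2⟩ := (h.and h').exists
  refine (T.convex k).segment_subset h1 h2 ⟨1 / 2, 1 / 2, by norm_num, by norm_num, by norm_num, ?_⟩
  match_scalars <;> ring

variable (T) in
/-- The points in the closure of at least three cells. -/
def multi : Set E := {x | 3 ≤ {k | x ∈ closure (T.cell k)}.encard}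

/-- A cell that touches `x` and lies neither to its left nor to its right on the horizontal line
is strictly above or strictly below `x`. -/
lemma height_lt_or_lt (hx : x ∈ closure (T.cell k)) (hl : ¬ T.Left x k) (hr : ¬ T.Right x k) :
    (∀ z ∈ T.cell k, T.height x < T.height z) ∨ (∀ z ∈ T.cell k, T.height z < T.height x) := by
  by_contra! h
  obtain ⟨⟨z₁, h1, h1'⟩, z₂, h2, h2'⟩ := h
  obtain ⟨z, hz, hz'⟩ : ∃ z ∈ T.cell k, T.height z = T.height x :=
    (T.convex k).isPreconnected.intermediate_value h1 h2 T.height.continuous.continuousOn ⟨h1', h2'⟩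
  obtain ⟨t, ht⟩ := T.exists_smul (z - x) (by simp [hz'])
  obtain rfl : z = x + t • T.dir := by rw [← ht]; abel
  rcases lt_trichotomy t 0 with h0 | rfl | h0
  · exact hl (left_of_mem hx (neg_pos.2 h0) (by simpa using hz))
  · simp only [zero_smul, add_zero] at hz
    apply hr
    have : Tendsto (fun ε : ℝ => x + ε • T.dir) (𝓝[>] 0) (𝓝 x) := by
      have : Tendsto (fun ε : ℝ => x + ε • T.dir) (𝓝 0) (𝓝 (x + (0:ℝ) • T.dir)) :=
        Continuous.tendsto (by fun_prop) 0
      simpa using this.mono_left nhdsWithin_le_nhds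
    exact this ((T.isOpen k).mem_nhds hz)
  · exact hr (right_of_mem hx h0 hz)

lemma height_le_of_closure {a : ℝ} (h : ∀ z ∈ T.cell k, a < T.height z)
    (hx : x ∈ closure (T.cell k)) : a ≤ T.height x :=
  closure_minimal (fun z hz => (h z hz).le) (isClosed_le continuous_const T.height.continuous) hx

/-- The boundary of a cell has no horizontal segment at the height of its lowest or highest point:
most points of such a segment would lie in another cell. -/
lemma not_pos_of_forall_height_ne {t : ℝ} (hx : x ∈ closure (T.cell k))
    (hy : x + t • T.dir ∈ closure (T.cell k)) (h : ∀ z ∈ T.cell k, T.height z ≠ T.height x) :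
    ¬ 0 < t := by
  intro ht
  obtain ⟨s, hs, hs'⟩ := ((Ioo_infinite ht).sdiff (T.finite_compl x)).nonempty
  simp only [mem_ofPred_eq, not_forall, not_not] at hs'
  obtain ⟨k', hk'⟩ := hs'
  have h1 : x + s • T.dir ∈ closure (T.cell k) := by
    refine (T.convex k).closure.segment_subset hx hy ⟨1 - s / t, s / t, ?_, (div_pos hs.1 ht).le,
      by ring, ?_⟩
    · have := (div_lt_one ht).2 hs.2
      linarith
    · match_scalars <;> field_simp <;> ring
  obtain rfl := eq_of_mem_closure hk' h1
  exact h _ hk' (by simp [T.height_dir])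

lemma eq_of_height_eq (hx : x ∈ closure (T.cell k)) (hy : y ∈ closure (T.cell k))
    (hxy : T.height x = T.height y) (h : ∀ z ∈ T.cell k, T.height z ≠ T.height x) : x = y := by
  obtain ⟨t, ht⟩ := T.exists_smul (y - x) (by simp [hxy])
  obtain rfl : y = x + t • T.dir := by rw [← ht]; abel
  have h1 := not_pos_of_forall_height_ne hx hy h
  have h2 := not_pos_of_forall_height_ne (t := -t) hy (by simpa using hx)
    (by simpa [T.height_dir] using h)
  obtain rfl : t = 0 := by linarith
  simp

lemma eq_of_min (hx : x ∈ closure (T.cell k)) (hy : y ∈ closure (T.cell k))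
    (h : ∀ z ∈ T.cell k, T.height x < T.height z) (h' : ∀ z ∈ T.cell k, T.height y < T.height z) :
    x = y :=
  eq_of_height_eq hx hy (le_antisymm (height_le_of_closure h hy) (height_le_of_closure h' hx))
    fun z hz => (h z hz).ne'

variable (T) in
/-- The mirror image: up and down are exchanged. -/
def upsideDown : ConvexSubdivision κ E where
  cell := T.cell
  isOpen := T.isOpen
  convex := T.convex
  eq_of_mem := T.eq_of_mem
  dir := T.dir
  height := -T.height
  height_dir := by simp [T.height_dir]
  exists_smul x hx := T.exists_smul x (by simpa using hx)
  finite_compl := T.finite_compl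

lemma exists_extremal [Finite κ] (hx : x ∈ T.multi) : ∃ k, x ∈ closure (T.cell k) ∧
    ((∀ z ∈ T.cell k, T.height x < T.height z) ∨ (∀ z ∈ T.cell k, T.height z < T.height x)) := by
  obtain ⟨k₁, h1⟩ := T.exists_left x
  obtain ⟨k₂, h2⟩ := T.exists_right x
  obtain ⟨k, hk, hk'⟩ : ∃ k ∈ {k | x ∈ closure (T.cell k)}, k ∉ ({k₁, k₂} : Set κ) := by
    by_contra! h
    have h3 : (3 : ℕ∞) ≤ 2 := hx.trans ((encard_le_encard h).trans
      ((encard_insert_le _ _).trans (by rw [encard_singleton]; norm_num)))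
    exact absurd h3 (by decide)
  simp only [mem_insert_iff, mem_singleton_iff, not_or] at hk'
  exact ⟨k, hk, height_lt_or_lt hk (fun h => hk'.1 (h.unique h1)) (fun h => hk'.2 (h.unique h2))⟩

variable (T) in
theorem encard_multi_le [Finite κ] : T.multi.encard ≤ 2 * (Nat.card κ : ℕ∞) := by
  classical
  choose f hf hf' using fun x : T.multi => exists_extremal x.2
  let g : T.multi → κ × Bool := fun x =>
    (f x, decide (∀ z ∈ T.cell (f x), T.height x.1 < T.height z))
  have hg : Function.Injective g := by
    intro x y hxy
    simp only [g, Prod.mk.injEq, decide_eq_decide] at hxy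
    obtain ⟨h1, h2⟩ := hxy
    have hx1 := hf x
    have hy1 := hf y
    have hx2 := hf' x
    have hy2 := hf' y
    rw [h1] at hx1 hx2 h2
    apply Subtype.ext
    by_cases hc : ∀ z ∈ T.cell (f y), T.height x.1 < T.height z
    · exact eq_of_min hx1 hy1 hc (h2.1 hc)
    · refine eq_of_min (T := T.upsideDown) hx1 hy1 ?_ ?_
      · simpa [upsideDown] using hx2.resolve_left hc
      · simpa [upsideDown] using hy2.resolve_left (fun h => hc (h2.2 h))
  refine (ENat.card_le_card_of_injective hg).trans ?_
  rw [ENat.card_eq_coe_natCard, Nat.card_prod]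
  simp [mul_comm]

variable (T) in
/-- At the point `x` the cell `k₁` is the left and `k₂` the right neighbour on the horizontal
line. -/
def Adj (k₁ k₂ : κ) (x : E) : Prop := k₁ ≠ k₂ ∧ T.Left x k₁ ∧ T.Right x k₂

lemma Adj.flip (h : T.Adj k₁ k₂ x) : T.flip.Adj k₂ k₁ x :=
  ⟨h.1.symm, T.flip_left.2 h.2.2, T.flip_right.2 h.2.1⟩

lemma convex_adj : Convex ℝ {x | T.Adj k₁ k₂ x} := by
  intro x hx y hy a b ha hb hab
  refine ⟨hx.1, ?_, ?_⟩
  · filter_upwards [hx.2.1, hy.2.1] with ε h1 h2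
    have := T.convex k₁ h1 h2 ha hb hab
    convert this using 1
    obtain rfl : b = 1 - a := by linarith
    match_scalars <;> ring
  · filter_upwards [hx.2.2, hy.2.2] with ε h1 h2
    have := T.convex k₂ h1 h2 ha hb hab
    convert this using 1
    obtain rfl : b = 1 - a := by linarith
    match_scalars <;> ring

lemma Adj.not_pos {t : ℝ} (h : T.Adj k₁ k₂ x) (h' : T.Left (x + t • T.dir) k₁) : ¬ 0 < t := by
  intro ht
  obtain ⟨ε, ⟨⟨h1, h2⟩, h3⟩, h4⟩ :=
    (((h.2.1.and h.2.2).and h').and (Ioo_mem_nhdsGT (half_pos ht))).exists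
  refine h.1 (T.eq_of_mem (x := x + ε • T.dir) ?_ h2)
  refine (T.convex k₁).segment_subset h1 h3 ⟨1 - 2 * ε / t, 2 * ε / t, ?_, ?_, by ring, ?_⟩
  · rw [sub_nonneg, div_le_one ht]; linarith [h4.2]
  · exact div_nonneg (by linarith [h4.1]) ht.le
  · match_scalars <;> field_simp <;> ring

lemma Adj.eq_of_height_eq (h : T.Adj k₁ k₂ x) (h' : T.Adj k₁ k' y)
    (hxy : T.height x = T.height y) : x = y := by
  obtain ⟨t, ht⟩ := T.exists_smul (y - x) (by simp [hxy])
  obtain rfl : y = x + t • T.dir := by rw [← ht]; abel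
  have h1 := h.not_pos h'.2.1
  have h2 := h'.not_pos (t := -t) (by simpa using h.2.1)
  obtain rfl : t = 0 := by linarith
  simp

lemma Adj.right_unique (h : T.Adj k₁ k₂ x) (h' : T.Adj k₁ k' y)
    (hxy : T.height x = T.height y) : k₂ = k' := by
  obtain rfl := h.eq_of_height_eq h' hxy
  exact h.2.2.unique h'.2.2

lemma exists_adj_height {a : ℝ} (h : T.Adj k₁ k₂ x) (h' : T.Adj k₁ k₂ y)
    (ha : T.height x ≤ a) (ha' : a ≤ T.height y) : ∃ z, T.Adj k₁ k₂ z ∧ T.height z = a :=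
  convex_adj.isPreconnected.intermediate_value h h' T.height.continuous.continuousOn ⟨ha, ha'⟩

/-- If the contact of `k₁` with its right neighbour goes down as far as `k₁` itself, then `k₁`
determines the neighbour. -/
lemma Adj.eq_of_bottom (h : T.Adj k₁ k₂ x) (h' : T.Adj k₁ k' y)
    (hb : ∀ z ∈ T.cell k₁, ∃ v, T.Adj k₁ k₂ v ∧ T.height v ≤ T.height z)
    (hb' : ∀ z ∈ T.cell k₁, ∃ v, T.Adj k₁ k' v ∧ T.height v ≤ T.height z) : k₂ = k' := by
  have key : ∀ {l v}, T.Adj k₁ l v → ∃ z ∈ T.cell k₁, T.height z = T.height v := by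
    intro l v hv
    obtain ⟨ε, hε⟩ := hv.2.1.exists
    exact ⟨_, hε, by simp [T.height_dir]⟩
  obtain ⟨z₁, hz₁, e₁⟩ := key h
  obtain ⟨z₂, hz₂, e₂⟩ := key h'
  obtain ⟨z₀, hz₀, e₀, e₀'⟩ : ∃ z ∈ T.cell k₁,
      T.height z ≤ T.height x ∧ T.height z ≤ T.height y := by
    rcases le_total (T.height z₁) (T.height z₂) with h | h
    · exact ⟨z₁, hz₁, e₁.le, e₂ ▸ h⟩
    · exact ⟨z₂, hz₂, e₁ ▸ h, e₂.le⟩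
  obtain ⟨v, hv, hv'⟩ := hb z₀ hz₀
  obtain ⟨z₃, hz₃, e₃⟩ := key hv
  obtain ⟨u, hu, hu'⟩ := hb' z₃ hz₃
  obtain ⟨u', h1, h2⟩ := exists_adj_height hu h' (a := T.height v) (e₃ ▸ hu') (hv'.trans e₀')
  exact hv.right_unique h1 h2.symm

/-- On a horizontal line that meets both cells, a common boundary point separates them. -/
lemma adj_of_mem_closure {t u : ℝ} (h₁ : y ∈ T.cell k₁) (ht : 0 < t)
    (h₂ : y + t • T.dir ∈ T.cell k₂) (hk : k₁ ≠ k₂) (hu₁ : y + u • T.dir ∈ closure (T.cell k₁))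
    (hu₂ : y + u • T.dir ∈ closure (T.cell k₂)) :
    0 < u ∧ u < t ∧ T.Adj k₁ k₂ (y + u • T.dir) := by
  have h0 : 0 < u := by
    by_contra! hu
    rcases hu.lt_or_eq with hu | rfl
    · have := openSegment_mem hu₂ h₂ (show y ∈ _ from
        ⟨t / (t - u), -u / (t - u), div_pos ht (by linarith),
          div_pos (by linarith) (by linarith), by
          have : t - u ≠ 0 := by linarith
          field_simp; ring, by
          have : t - u ≠ 0 := by linarith
          match_scalars <;> field_simp <;> ring⟩)
      exact hk (T.eq_of_mem h₁ this)
    · exact hk (eq_of_mem_closure h₁ (by simpa using hu₂))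
  have h0' : u < t := by
    by_contra! hu
    rcases hu.lt_or_eq with hu | rfl
    · have := openSegment_mem hu₁ h₁ (show y + t • T.dir ∈ _ from
        ⟨t / u, 1 - t / u, div_pos ht h0, by rw [sub_pos, div_lt_one h0]; exact hu, by ring, by
          match_scalars <;> field_simp <;> ring⟩)
      exact hk (T.eq_of_mem this h₂)
    · exact hk.symm (eq_of_mem_closure h₂ hu₁)
  refine ⟨h0, h0', hk, left_of_mem hu₁ h0 (by simpa using h₁), right_of_mem hu₂ (sub_pos.2 h0') ?_⟩
  convert h₂ using 1
  match_scalars <;> ring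

/-- If a horizontal segment leads from `k₁` to `k₂` and touches no other cell, then the two cells
have a common boundary point on its line. -/
lemma exists_mem_closure_inter [Finite κ] {y : E} {t : ℝ} (h₁ : y ∈ T.cell k₁) (ht : 0 ≤ t)
    (h₂ : y + t • T.dir ∈ T.cell k₂)
    (h : ∀ u ∈ Icc (0:ℝ) t, ∀ k, y + u • T.dir ∈ closure (T.cell k) → k = k₁ ∨ k = k₂) :
    ∃ u : ℝ, y + u • T.dir ∈ closure (T.cell k₁) ∧ y + u • T.dir ∈ closure (T.cell k₂) := by
  have hc : Continuous fun u : ℝ => y + u • T.dir := by fun_prop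
  have := isPreconnected_closed_iff.1 (isPreconnected_Icc (a := (0:ℝ)) (b := t))
    _ _ ((isClosed_closure (s := T.cell k₁)).preimage hc)
    ((isClosed_closure (s := T.cell k₂)).preimage hc) ?_ ?_ ?_
  · obtain ⟨u, -, h1, h2⟩ := this
    exact ⟨u, h1, h2⟩
  · intro u hu
    obtain ⟨k, hk⟩ := T.exists_right (y + u • T.dir)
    rcases h u hu k hk.mem_closure with rfl | rfl
    · exact Or.inl hk.mem_closure
    · exact Or.inr hk.mem_closure
  · exact ⟨0, ⟨le_rfl, ht⟩, by simpa using subset_closure h₁⟩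
  · exact ⟨t, ⟨ht, le_rfl⟩, by simpa using subset_closure h₂⟩

lemma Adj.eq_or_eq (h : T.Adj k₁ k₂ x) (hx : x ∉ T.multi) (hk : x ∈ closure (T.cell k)) :
    k = k₁ ∨ k = k₂ := by
  by_contra! h'
  apply hx
  have : ({k, k₁, k₂} : Set κ) ⊆ {k | x ∈ closure (T.cell k)} := by
    rintro l (rfl | rfl | rfl)
    exacts [hk, h.2.1.mem_closure, h.2.2.mem_closure]
  have h3 := encard_le_encard this
  rwa [encard_insert_of_notMem (by simp [h'.1, h'.2]), encard_pair h.1] at h3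

lemma Adj.eventually_eq_or_eq [Finite κ] (h : T.Adj k₁ k₂ x) (hx : x ∉ T.multi) :
    ∀ᶠ y in 𝓝 x, ∀ k, y ∈ closure (T.cell k) → k = k₁ ∨ k = k₂ := by
  refine eventually_all.2 fun k => ?_
  by_cases hk : k = k₁ ∨ k = k₂
  · exact Eventually.of_forall fun _ _ => hk
  · filter_upwards [isClosed_closure.isOpen_compl.mem_nhds fun h' => hk (h.eq_or_eq hx h')]
      with y hy hy'
    exact absurd hy' hy

/-- The contact of two cells continues in every direction from a point that touches no third
cell. -/
lemma Adj.exists_shift [Finite κ] (h : T.Adj k₁ k₂ x) (hx : x ∉ T.multi) (e : E) :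
    ∀ᶠ r : ℝ in 𝓝[>] 0, ∃ u : ℝ, x + r • e + u • T.dir ∈ closure (T.cell k₁) ∧
      x + r • e + u • T.dir ∈ closure (T.cell k₂) := by
  obtain ⟨ρ, hρ, hball⟩ := Metric.eventually_nhds_iff.1 (h.eventually_eq_or_eq hx)
  have hc : Tendsto (fun ε : ℝ => ε * ‖T.dir‖) (𝓝[>] 0) (𝓝 0) := by
    have : Tendsto (fun ε : ℝ => ε * ‖T.dir‖) (𝓝 0) (𝓝 (0 * ‖T.dir‖)) :=
      Continuous.tendsto (by fun_prop) 0
    rw [zero_mul] at this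
    exact this.mono_left nhdsWithin_le_nhds
  obtain ⟨ε, ⟨⟨h1, h2⟩, h3⟩, h4⟩ := (((h.2.1.and h.2.2).and
    (hc.eventually (gt_mem_nhds (half_pos hρ)))).and self_mem_nhdsWithin).exists
  have h4 : 0 < ε := h4
  have e1 : ∀ᶠ r : ℝ in 𝓝 0, x - ε • T.dir + r • e ∈ T.cell k₁ :=
    (Continuous.tendsto (f := fun r : ℝ => x - ε • T.dir + r • e) (by fun_prop) 0).eventually
      ((T.isOpen k₁).mem_nhds (by simpa using h1))
  have e2 : ∀ᶠ r : ℝ in 𝓝 0, x + ε • T.dir + r • e ∈ T.cell k₂ :=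
    (Continuous.tendsto (f := fun r : ℝ => x + ε • T.dir + r • e) (by fun_prop) 0).eventually
      ((T.isOpen k₂).mem_nhds (by simpa using h2))
  have e3 : ∀ᶠ r : ℝ in 𝓝 0, ‖r • e‖ < ρ / 2 :=
    (Continuous.tendsto (f := fun r : ℝ => ‖r • e‖) (by fun_prop) 0).eventually
      (gt_mem_nhds (by simpa using hρ))
  filter_upwards [mem_nhdsWithin_of_mem_nhds e1, mem_nhdsWithin_of_mem_nhds e2,
    mem_nhdsWithin_of_mem_nhds e3] with r h5 h6 h7
  -- the horizontal segment from `x - ε • dir` to `x + ε • dir`, moved by `r • e`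
  obtain ⟨u, hu1, hu2⟩ := exists_mem_closure_inter (t := 2 * ε) h5 (by linarith) (by
      convert h6 using 1
      match_scalars <;> ring) (by
      intro u hu
      apply hball
      have : x - ε • T.dir + r • e + u • T.dir = x + (r • e + (u - ε) • T.dir) := by
        match_scalars <;> ring
      rw [this, dist_self_add_left]
      have h8 : ‖(u - ε) • T.dir‖ ≤ ε * ‖T.dir‖ := by
        rw [norm_smul, Real.norm_eq_abs]
        gcongr
        exact abs_le.2 ⟨by linarith [hu.1], by linarith [hu.2]⟩
      linarith [norm_add_le (r • e) ((u - ε) • T.dir)])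
  refine ⟨u - ε, ?_, ?_⟩
  · convert hu1 using 1
    match_scalars <;> ring
  · convert hu2 using 1
    match_scalars <;> ring

/-- Left and right are the same at all heights: otherwise two segments, one in each cell, would
cross. -/
lemma Adj.pos_of_mem {t : ℝ} (h : T.Adj k₁ k₂ x) (hz : z ∈ T.cell k₁)
    (hz' : z + t • T.dir ∈ T.cell k₂) : 0 < t := by
  by_contra! ht
  obtain ⟨ε, ⟨h1, h2⟩, h3⟩ := ((h.2.1.and h.2.2).and self_mem_nhdsWithin).exists
  have h3 : 0 < ε := h3
  have hp : 0 < 2 * ε - t := by linarith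
  have hp' := hp.ne'
  have a0 : 0 ≤ -t / (2 * ε - t) := div_nonneg (by linarith) hp.le
  have b0 : 0 ≤ 2 * ε / (2 * ε - t) := div_nonneg (by linarith) hp.le
  have ab : -t / (2 * ε - t) + 2 * ε / (2 * ε - t) = 1 := by field_simp; ring
  have m1 := T.convex k₁ h1 hz a0 b0 ab
  have m2 := T.convex k₂ h2 hz' a0 b0 ab
  refine h.1 (T.eq_of_mem m1 ?_)
  convert m2 using 1
  match_scalars <;> field_simp <;> ring

/-- Two cells in contact at `x` that both reach a height at which they are not in contact have a
point of contact that touches a third cell. Within the triangle with vertices `x`, `z`, `z'`, it is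
the contact farthest from the height of `x`. -/
lemma Adj.exists_multi [Finite κ] {z' : E} (h : T.Adj k₁ k₂ x) (hz : z ∈ T.cell k₁)
    (hz' : z' ∈ T.cell k₂) (hzz : T.height z = T.height z')
    (hb : ∀ v, T.Adj k₁ k₂ v → T.height v ≠ T.height z) : ∃ v ∈ T.multi, T.Adj k₁ k₂ v := by
  obtain ⟨t, ht'⟩ := T.exists_smul (z' - z) (by simp [hzz])
  obtain rfl : z' = z + t • T.dir := by rw [← ht']; abel
  have ht := h.pos_of_mem hz hz'
  let Ψ : ℝ × ℝ → E := fun p => (1 - p.1) • x + p.1 • z + p.2 • T.dir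
  have hΨ : Continuous Ψ := by fun_prop
  -- a common boundary point at parameter `s` lies between the sides `x z` and `x z'`
  have inside : ∀ s u : ℝ, 0 < s → s ≤ 1 → Ψ (s, u) ∈ closure (T.cell k₁) →
      Ψ (s, u) ∈ closure (T.cell k₂) → 0 < u ∧ u < s * t ∧ T.Adj k₁ k₂ (Ψ (s, u)) := by
    intro s u hs hs1 m1 m2
    have conv : ∀ {k y y'}, y ∈ closure (T.cell k) → y' ∈ T.cell k →
        (1 - s) • y + s • y' ∈ T.cell k := by
      intro k y y' hy hy'
      rcases hs1.lt_or_eq with hs1 | rfl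
      · exact openSegment_mem hy hy' ⟨1 - s, s, by linarith, hs, by ring, rfl⟩
      · simpa using hy'
    have c1 := conv h.2.1.mem_closure hz
    have c2 := conv h.2.2.mem_closure hz'
    exact adj_of_mem_closure (t := s * t) c1 (by positivity) (by
      convert c2 using 1
      match_scalars <;> ring) h.1 m1 m2
  let K : Set (ℝ × ℝ) := (Icc 0 1 ×ˢ Icc 0 t) ∩
    (Ψ ⁻¹' closure (T.cell k₁) ∩ Ψ ⁻¹' closure (T.cell k₂))
  have hK : IsCompact K := (isCompact_Icc.prod isCompact_Icc).inter_right
    ((isClosed_closure.preimage hΨ).inter (isClosed_closure.preimage hΨ))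
  have hne : K.Nonempty := ⟨(0, 0), ⟨by simp [ht.le], by simpa [Ψ] using h.2.1.mem_closure,
    by simpa [Ψ] using h.2.2.mem_closure⟩⟩
  obtain ⟨⟨s, u⟩, ⟨⟨⟨hs0, hs1⟩, hu⟩, m1, m2⟩, hmax⟩ :=
    hK.exists_isMaxOn hne continuous_fst.continuousOn
  simp only at hs0 hs1 hu
  by_cases hadj : T.Adj k₁ k₂ (Ψ (s, u))
  swap
  · -- then `s = 0`
    exfalso
    rcases hs0.lt_or_eq with hs0 | rfl
    · exact hadj (inside s u hs0 hs1 m1 m2).2.2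
    · rcases hu.1.lt_or_eq with hu | rfl
      · have m1' : x + u • T.dir ∈ closure (T.cell k₁) := by simpa [Ψ] using m1
        obtain ⟨ε, h1, h2⟩ := (h.2.2.and (Ioo_mem_nhdsGT hu)).exists
        obtain ⟨ε', h1', h2'⟩ := (h.2.1.and self_mem_nhdsWithin).exists
        have h2' : 0 < ε' := h2'
        have hp : 0 < u + ε' := by linarith
        have := openSegment_mem m1' h1' (show x + ε • T.dir ∈ _ from
          ⟨(ε + ε') / (u + ε'), (u - ε) / (u + ε'), div_pos (by linarith [h2.1]) hp,
            div_pos (by linarith [h2.2]) hp, by field_simp; ring, by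
            match_scalars <;> field_simp <;> ring⟩)
        exact h.1 (T.eq_of_mem this h1)
      · exact hadj (by simpa [Ψ] using h)
  refine ⟨_, ?_, hadj⟩
  by_contra hmulti
  rcases hs1.lt_or_eq with hs1 | rfl
  · obtain ⟨r, ⟨u', m1', m2'⟩, hr⟩ :=
      ((hadj.exists_shift hmulti (z - Ψ (s, u))).and (Ioo_mem_nhdsGT one_pos)).exists
    have eq : Ψ (s, u) + r • (z - Ψ (s, u)) + u' • T.dir =
        Ψ (s + r * (1 - s), (1 - r) * u + u') := by
      simp only [Ψ]
      match_scalars <;> ring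
    rw [eq] at m1' m2'
    have hlt : 0 < r * (1 - s) := mul_pos hr.1 (by linarith)
    have hle : s + r * (1 - s) ≤ 1 := by nlinarith [hr.2]
    obtain ⟨i1, i2, -⟩ := inside _ _ (by linarith) hle m1' m2'
    have := hmax (show (s + r * (1 - s), (1 - r) * u + u') ∈ K from
      ⟨⟨⟨by linarith, hle⟩, i1.le, i2.le.trans (by nlinarith)⟩, m1', m2'⟩)
    simp only [mem_ofPred_eq] at this
    linarith
  · exact hb _ hadj (by simp [Ψ, T.height_dir])

end ConvexSubdivision

namespace ConvexSubdivision

variable {κ E : Type*} [NormedAddCommGroup E] [NormedSpace ℝ E] {T : ConvexSubdivision κ E}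
  {x y z : E} {k k' k₁ k₂ : κ}

variable (T) in
/-- The pairs of cells that are horizontal neighbours somewhere. -/
def adjPairs : Set (κ × κ) := {p | ∃ x, T.Adj p.1 p.2 x}

variable (T) in
/-- The contact of the pair `p` goes down at least as far as the cell `k`. -/
def ReachesBottom (p : κ × κ) (k : κ) : Prop :=
  ∀ z ∈ T.cell k, ∃ v, T.Adj p.1 p.2 v ∧ T.height v ≤ T.height z

lemma Adj.exists_multi_of_not_reachesBottom [Finite κ] (h : T.Adj k₁ k₂ x)
    (h₁ : ¬ T.ReachesBottom (k₁, k₂) k₁) (h₂ : ¬ T.ReachesBottom (k₁, k₂) k₂) :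
    ∃ v ∈ T.multi, T.Adj k₁ k₂ v := by
  simp only [ReachesBottom, not_forall, not_exists, not_and, not_le] at h₁ h₂
  obtain ⟨z₁, hz₁, b₁⟩ := h₁
  obtain ⟨z₂, hz₂, b₂⟩ := h₂
  obtain ⟨ε, e₁, e₂⟩ := (h.2.1.and h.2.2).exists
  have hx₁ : T.height (x - ε • T.dir) = T.height x := by simp [T.height_dir]
  have hx₂ : T.height (x + ε • T.dir) = T.height x := by simp [T.height_dir]
  rcases le_total (T.height z₁) (T.height z₂) with hle | hle
  · obtain ⟨z, hz, hz'⟩ : ∃ z ∈ T.cell k₁, T.height z = T.height z₂ :=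
      (T.convex k₁).isPreconnected.intermediate_value hz₁ e₁ T.height.continuous.continuousOn
        ⟨hle, hx₁ ▸ (b₂ x h).le⟩
    exact h.exists_multi hz hz₂ hz' fun v hv => hz' ▸ (b₂ v hv).ne'
  · obtain ⟨z, hz, hz'⟩ : ∃ z ∈ T.cell k₂, T.height z = T.height z₁ :=
      (T.convex k₂).isPreconnected.intermediate_value hz₂ e₂ T.height.continuous.continuousOn
        ⟨hle, hx₂ ▸ (b₁ x h).le⟩
    exact h.exists_multi hz₁ hz hz'.symm fun v hv => (b₁ v hv).ne'

variable (T) in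
theorem encard_adjPairs_le [Finite κ] : T.adjPairs.encard ≤ 4 * (Nat.card κ : ℕ∞) := by
  classical
  have inj₁ : InjOn Prod.fst {p ∈ T.adjPairs | T.ReachesBottom p p.1} := by
    rintro ⟨k₁, k₂⟩ ⟨⟨x, hx⟩, hp⟩ ⟨l₁, l₂⟩ ⟨⟨y, hy⟩, hq⟩ (rfl : k₁ = l₁)
    exact Prod.ext rfl (Adj.eq_of_bottom hx hy hp hq)
  have inj₂ : InjOn Prod.snd {p ∈ T.adjPairs | T.ReachesBottom p p.2} := by
    rintro ⟨k₁, k₂⟩ ⟨⟨x, hx⟩, hp⟩ ⟨l₁, l₂⟩ ⟨⟨y, hy⟩, hq⟩ (rfl : k₂ = l₂)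
    exact Prod.ext (Adj.eq_of_bottom hx.flip hy.flip
      (fun z hz => (hp z hz).imp fun v hv => ⟨hv.1.flip, hv.2⟩)
      (fun z hz => (hq z hz).imp fun v hv => ⟨hv.1.flip, hv.2⟩)) rfl
  choose l hl using T.exists_left
  choose r hr using T.exists_right
  have hsub : T.adjPairs ⊆ {p ∈ T.adjPairs | T.ReachesBottom p p.1} ∪
      {p ∈ T.adjPairs | T.ReachesBottom p p.2} ∪ (fun v => (l v, r v)) '' T.multi := by
    rintro ⟨k₁, k₂⟩ ⟨x, hx⟩
    by_cases h₁ : T.ReachesBottom (k₁, k₂) k₁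
    · exact Or.inl (Or.inl ⟨⟨x, hx⟩, h₁⟩)
    by_cases h₂ : T.ReachesBottom (k₁, k₂) k₂
    · exact Or.inl (Or.inr ⟨⟨x, hx⟩, h₂⟩)
    obtain ⟨v, hv, hv'⟩ := Adj.exists_multi_of_not_reachesBottom hx h₁ h₂
    exact Or.inr ⟨v, hv, Prod.ext ((hl v).unique hv'.2.1) ((hr v).unique hv'.2.2)⟩
  have hcard : ∀ s : Set κ, s.encard ≤ (Nat.card κ : ℕ∞) := fun s =>
    (encard_le_encard (subset_univ s)).trans (by rw [encard_univ, ENat.card_eq_coe_natCard])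
  calc T.adjPairs.encard ≤ _ := encard_le_encard hsub
    _ ≤ (Nat.card κ : ℕ∞) + Nat.card κ + 2 * Nat.card κ := by
      refine (encard_union_le _ _).trans (add_le_add ((encard_union_le _ _).trans
        (add_le_add ?_ ?_)) ((encard_image_le _ _).trans T.encard_multi_le))
      · rw [← inj₁.encard_image]; exact hcard _
      · rw [← inj₂.encard_image]; exact hcard _
    _ = 4 * (Nat.card κ : ℕ∞) := by ring

/-- No third cell touches the interior of a segment along which two cells are in contact. -/
lemma Adj.openSegment_notMem_multi (h : T.Adj k₁ k₂ x) (h' : T.Adj k₁ k₂ y)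
    {v : E} (hv : v ∈ openSegment ℝ x y) (hxy : x ≠ y) : v ∉ T.multi := by
  have hh : T.height y - T.height x ≠ 0 := fun hh =>
    hxy (h.eq_of_height_eq h' (by linarith))
  have hvadj : T.Adj k₁ k₂ v := convex_adj.openSegment_subset h h' hv
  obtain ⟨a, s, ha, hs, has, rfl⟩ := hv
  obtain rfl : a = 1 - s := by linarith
  set v := (1 - s) • x + s • y with hvdef
  -- points of a third cell near `v` lie slightly to the left or right of the segment, hence in
  -- `k₁` or `k₂`
  have key : ∀ k, v ∈ closure (T.cell k) → k = k₁ ∨ k = k₂ := by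
    intro k hk
    obtain ⟨z, hz⟩ : (T.cell k).Nonempty := closure_nonempty_iff.1 ⟨v, hk⟩
    set c := (T.height z - T.height v) / (T.height y - T.height x) with hc
    obtain ⟨β, hβ⟩ := T.exists_smul (z - v - c • (y - x)) (by
      simp only [map_sub, map_smul, smul_eq_mul, hc]
      field_simp; ring)
    have hzr : ∀ r : ℝ, (1 - r) • v + r • z =
        (1 - (s + r * c)) • x + (s + r * c) • y + (r * β) • T.dir := by
      intro r
      have hz : z = v + c • (y - x) + β • T.dir := by rw [← hβ]; abel
      conv_lhs => rw [hz, hvdef]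
      match_scalars <;> ring
    have e1 : ∀ᶠ r : ℝ in 𝓝[>] 0, 0 < s + r * c ∧ s + r * c < 1 := by
      have : Tendsto (fun r : ℝ => s + r * c) (𝓝 0) (𝓝 (s + 0 * c)) :=
        Continuous.tendsto (by fun_prop) 0
      rw [zero_mul, add_zero] at this
      exact (this.mono_left nhdsWithin_le_nhds).eventually
        (Ioo_mem_nhds hs (by linarith))
    have htend : ∀ b : ℝ, 0 < b → Tendsto (fun r : ℝ => r * b) (𝓝[>] 0) (𝓝[>] 0) := by
      intro b hb
      refine tendsto_nhdsWithin_iff.2 ⟨?_, ?_⟩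
      · have : Tendsto (fun r : ℝ => r * b) (𝓝 0) (𝓝 (0 * b)) :=
          Continuous.tendsto (by fun_prop) 0
        rw [zero_mul] at this
        exact this.mono_left nhdsWithin_le_nhds
      · filter_upwards [self_mem_nhdsWithin] with r hr using mul_pos hr hb
    have e2 : ∀ᶠ r : ℝ in 𝓝[>] 0, (1 - r) • v + r • z ∈ T.cell k := by
      filter_upwards [Ioo_mem_nhdsGT one_pos] with r hr
      exact openSegment_mem hk hz ⟨1 - r, r, by linarith [hr.2], hr.1, by ring, rfl⟩
    rcases lt_trichotomy β 0 with hb | rfl | hb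
    · left
      obtain ⟨r, ⟨⟨h1, h2⟩, h3⟩, h4⟩ := (((e1.and e2).and
        ((htend (-β) (by linarith)).eventually h.2.1)).and
        ((htend (-β) (by linarith)).eventually h'.2.1)).exists
      refine T.eq_of_mem h2 ?_
      have := T.convex k₁ h3 h4 (show 0 ≤ 1 - (s + r * c) by linarith) h1.1.le (by ring)
      rw [hzr]
      convert this using 1
      match_scalars <;> ring
    · left
      obtain ⟨r, h1, h2⟩ := (e1.and e2).exists
      have := convex_adj (T := T) (k₁ := k₁) (k₂ := k₂) h h'
        (show 0 ≤ 1 - (s + r * c) by linarith) h1.1.le (by ring)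
      rw [hzr, mul_zero, zero_smul, add_zero] at h2
      exact eq_of_mem_closure h2 this.2.1.mem_closure
    · right
      obtain ⟨r, ⟨⟨h1, h2⟩, h3⟩, h4⟩ := (((e1.and e2).and
        ((htend β hb).eventually h.2.2)).and ((htend β hb).eventually h'.2.2)).exists
      refine T.eq_of_mem h2 ?_
      have := T.convex k₂ h3 h4 (show 0 ≤ 1 - (s + r * c) by linarith) h1.1.le (by ring)
      rw [hzr]
      convert this using 1
      match_scalars <;> ring
  intro hm
  have hm : (3 : ℕ∞) ≤ {k | v ∈ closure (T.cell k)}.encard := hm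
  have h2 : {k | v ∈ closure (T.cell k)}.encard ≤ ({k₁, k₂} : Set κ).encard :=
    encard_le_encard fun k hk => key k hk
  rw [encard_pair h.1] at h2
  exact absurd (hm.trans h2) (by decide)

end ConvexSubdivision

/-! ### The complexity of a diagram refined by a convex subdivision -/

lemma connectedComponentIn_eq_of_segment {S : Set Plane} {x y : Plane}
    (h : segment ℝ x y ⊆ S) : connectedComponentIn S x = connectedComponentIn S y :=
  connectedComponentIn_eq ((convex_segment x y).isPreconnected.subset_connectedComponentIn
    (left_mem_segment ℝ x y) h (right_mem_segment ℝ x y))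

namespace FCVD

variable {ι : Type} {P : ι → Set Plane} {κ : Type}

/-- Every cell of `T` lies in one region of the diagram, named by `label`; the regions are open,
disjoint, and equal to the interiors of their closures. -/
structure Refines (T : ConvexSubdivision κ Plane) (P : ι → Set Plane)
    (label : κ → Σ i, P i) : Prop where
  subset : ∀ k, T.cell k ⊆ region P (label k)
  isOpen : ∀ s, IsOpen (region P s)
  eq_of_mem : ∀ {s s' x}, x ∈ region P s → x ∈ region P s' → s = s'
  interior_closure : ∀ s, interior (closure (region P s)) ⊆ region P s

namespace Refines

variable {T : ConvexSubdivision κ Plane} {label : κ → Σ i, P i} (h : Refines T P label)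
include h

lemma exists_of_mem_closure [Finite κ] {s : Σ i, P i} {x : Plane} (hx : x ∈ closure (region P s)) :
    ∃ k, label k = s ∧ x ∈ closure (T.cell k) := by
  have hsub : region P s ⊆ ⋃ k ∈ {k | label k = s}, closure (T.cell k) := by
    intro y hy
    obtain ⟨k, hk⟩ := T.exists_right y
    obtain ⟨z, hz, hz'⟩ := mem_closure_iff.1 hk.mem_closure _ (h.isOpen s) hy
    exact mem_iUnion₂.2 ⟨k, h.eq_of_mem (h.subset k hz') hz, hk.mem_closure⟩
  have hcl : IsClosed (⋃ k ∈ {k | label k = s}, closure (T.cell k)) :=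
    (toFinite _).isClosed_biUnion fun _ _ => isClosed_closure
  obtain ⟨k, hk, hk'⟩ := mem_iUnion₂.1 (closure_minimal hsub hcl hx)
  exact ⟨k, hk, hk'⟩

lemma vertices_subset [Finite κ] : vertices P ⊆ T.multi := by
  intro x hx
  have : {s | x ∈ closure (region P s)} ⊆ label '' {k | x ∈ closure (T.cell k)} := by
    intro s hs
    obtain ⟨k, hk, hk'⟩ := h.exists_of_mem_closure hs
    exact ⟨k, hk', hk⟩
  exact le_trans hx ((encard_le_encard this).trans (encard_image_le _ _))

lemma encard_faces_le [Finite κ] : (faces P).encard ≤ Nat.card κ := by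
  classical
  let U := ⋃ s, region P s
  let f : κ → Set Plane := fun k =>
    if hk : (T.cell k).Nonempty then connectedComponentIn U hk.some else ∅
  have hsub : faces P ⊆ f '' univ := by
    rintro _ ⟨x, hx, rfl⟩
    obtain ⟨k, hk⟩ := T.exists_right x
    have ho : IsOpen U := isOpen_iUnion h.isOpen
    obtain ⟨y, hy, hyk⟩ := mem_closure_iff.1 hk.mem_closure _ ho.connectedComponentIn
      (mem_connectedComponentIn hx)
    have hne : (T.cell k).Nonempty := ⟨y, hyk⟩
    refine ⟨k, mem_univ k, ?_⟩
    simp only [f, dif_pos hne]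
    rw [connectedComponentIn_eq hy]
    exact connectedComponentIn_eq_of_segment
      (((T.convex k).segment_subset hne.some_mem hyk).trans
        ((h.subset k).trans (subset_iUnion (region P) _)))
  refine (encard_le_encard hsub).trans ((encard_image_le _ _).trans ?_)
  rw [encard_univ, ENat.card_eq_coe_natCard]

lemma mem_skeleton {k₁ k₂ : κ} {x : Plane} (hx : T.Adj k₁ k₂ x) (hl : label k₁ ≠ label k₂) :
    x ∈ skeleton P := by
  refine mem_iUnion.2 ⟨label k₁, closure_mono (h.subset k₁) hx.2.1.mem_closure, ?_⟩
  rw [(h.isOpen _).interior_eq]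
  intro hx1
  obtain ⟨z, hz, hz'⟩ := mem_closure_iff.1 hx.2.2.mem_closure _ (h.isOpen _) hx1
  exact hl (h.eq_of_mem hz (h.subset k₂ hz'))

/-- The last assumption of `Refines` rules out slits: a boundary point of a region touches another
region. -/
lemma exists_adj [Finite κ] {x : Plane} (hx : x ∈ skeleton P) (hm : x ∉ T.multi) :
    ∃ k₁ k₂, T.Adj k₁ k₂ x ∧ label k₁ ≠ label k₂ := by
  obtain ⟨s, hs, hs'⟩ := mem_iUnion.1 hx
  rw [(h.isOpen _).interior_eq] at hs'
  obtain ⟨k, hk, hxk⟩ := h.exists_of_mem_closure hs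
  obtain ⟨k', hk', hxk'⟩ : ∃ k', label k' ≠ s ∧ x ∈ closure (T.cell k') := by
    by_contra! hc
    refine hs' (h.interior_closure s (mem_interior_iff_mem_nhds.2 ?_))
    have hev : ∀ᶠ y in 𝓝 x, ∀ k, y ∈ closure (T.cell k) → label k = s := by
      refine eventually_all.2 fun l => ?_
      by_cases hl : label l = s
      · exact Eventually.of_forall fun _ _ => hl
      · filter_upwards [isClosed_closure.isOpen_compl.mem_nhds (hc l hl)] with y hy hy'
        exact absurd hy' hy
    filter_upwards [hev] with y hy
    obtain ⟨l, hl⟩ := T.exists_right y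
    rw [← hy l hl.mem_closure]
    exact closure_mono (h.subset l) hl.mem_closure
  obtain ⟨k₁, h1⟩ := T.exists_left x
  obtain ⟨k₂, h2⟩ := T.exists_right x
  have hne : k₁ ≠ k₂ := by
    rintro rfl
    have hmem := ConvexSubdivision.mem_of_left_right h1 h2
    have e1 := ConvexSubdivision.eq_of_mem_closure hmem hxk
    have e2 := ConvexSubdivision.eq_of_mem_closure hmem hxk'
    rw [← e2, e1] at hk'
    exact hk' hk
  have hadj : T.Adj k₁ k₂ x := ⟨hne, h1, h2⟩
  refine ⟨k₁, k₂, hadj, fun he => hk' ?_⟩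
  rcases hadj.eq_or_eq hm hxk with rfl | rfl <;> rcases hadj.eq_or_eq hm hxk' with rfl | rfl <;>
    simp_all

lemma encard_edges_le [Finite κ] : (edges P).encard ≤ 6 * (Nat.card κ : ℕ∞) := by
  classical
  let S := skeleton P \ vertices P
  -- an edge contains a point of `T.multi`, or it is found from a pair of neighbouring cells
  let Q : κ × κ → Set Plane := fun p => {x | x ∈ S ∧ x ∉ T.multi ∧ T.Adj p.1 p.2 x}
  let f : κ × κ → Set Plane := fun p =>
    if hp : (Q p).Nonempty then connectedComponentIn S hp.some else ∅
  have hsub : edges P ⊆ connectedComponentIn S '' T.multi ∪ f '' T.adjPairs := by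
    rintro _ ⟨x, hx, rfl⟩
    by_cases hm : x ∈ T.multi
    · exact Or.inl ⟨x, hm, rfl⟩
    right
    obtain ⟨k₁, k₂, hadj, hl⟩ := h.exists_adj hx.1 hm
    have hne : (Q (k₁, k₂)).Nonempty := ⟨x, hx, hm, hadj⟩
    refine ⟨(k₁, k₂), ⟨x, hadj⟩, ?_⟩
    simp only [f, dif_pos hne]
    obtain ⟨-, hym, hyadj⟩ := hne.some_mem
    refine connectedComponentIn_eq_of_segment fun v hv => ⟨h.mem_skeleton
      (ConvexSubdivision.convex_adj.segment_subset hyadj hadj hv) hl, fun hvv => ?_⟩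
    have hvm := h.vertices_subset hvv
    have hvx : v ≠ x := fun e => hm (e ▸ hvm)
    have hvy : v ≠ hne.some := fun e => hym (e ▸ hvm)
    refine hyadj.openSegment_notMem_multi hadj
      (mem_openSegment_of_ne_left_right hvy.symm hvx.symm hv) ?_ hvm
    intro e
    rw [e, segment_same] at hv
    exact hvx hv
  calc (edges P).encard ≤ _ := encard_le_encard hsub
    _ ≤ 2 * (Nat.card κ : ℕ∞) + 4 * (Nat.card κ : ℕ∞) :=
      (encard_union_le _ _).trans (add_le_add ((encard_image_le _ _).trans T.encard_multi_le)
        ((encard_image_le _ _).trans T.encard_adjPairs_le))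
    _ = 6 * (Nat.card κ : ℕ∞) := by ring

theorem complexity_le [Finite κ] : complexity P ≤ 9 * (Nat.card κ : ℕ∞) := by
  calc complexity P ≤ 2 * (Nat.card κ : ℕ∞) + 6 * (Nat.card κ : ℕ∞) + Nat.card κ :=
        add_le_add (add_le_add ((encard_le_encard h.vertices_subset).trans T.encard_multi_le)
          h.encard_edges_le) h.encard_faces_le
    _ = 9 * (Nat.card κ : ℕ∞) := by ring

end Refines

end FCVD

/-! ### Distances to the corners of a rectangle -/

lemma Plane.dist_sq {k l : Fin 2} (hkl : k ≠ l) (x y : Plane) :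
    dist x y ^ 2 = (x k - y k) ^ 2 + (x l - y l) ^ 2 := by
  rw [EuclideanSpace.dist_eq, Real.sq_sqrt (by positivity), Fin.sum_univ_two]
  simp only [Real.dist_eq, sq_abs]
  fin_cases k <;> fin_cases l <;> simp_all [add_comm]

namespace AxisRect

variable (R S : AxisRect) {k l : Fin 2}

/-- The squared distance from `s` to the two endpoints of the `k`-th side interval. The squared
distance to the corners is the sum of these over both coordinates. -/
def axisDistSq (k : Fin 2) (s : ℝ) : ℝ := min ((s - R.lo k) ^ 2) ((s - R.hi k) ^ 2)

lemma corners_finite : R.corners.Finite := by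
  refine (finite_range fun f : Fin 2 → Bool =>
    (WithLp.toLp 2 fun k => if f k then R.hi k else R.lo k : Plane)).subset ?_
  intro x hx
  classical
  refine ⟨fun k => decide (x k = R.hi k), ?_⟩
  ext k
  by_cases h : x k = R.hi k
  · simp [h]
  · simpa [h] using ((hx k).resolve_right h).symm

lemma corners_nonempty : R.corners.Nonempty := ⟨R.lo, fun _ => Or.inl rfl⟩

lemma axisDistSq_le {q : Plane} (hq : q ∈ R.corners) (k : Fin 2) (s : ℝ) :
    R.axisDistSq k s ≤ (s - q k) ^ 2 := by
  rcases hq k with h | h <;> rw [h]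
  exacts [min_le_left _ _, min_le_right _ _]

lemma exists_corner (x : Plane) : ∃ q ∈ R.corners, ∀ k, (x k - q k) ^ 2 = R.axisDistSq k (x k) := by
  have : ∀ k, ∃ a, (a = R.lo k ∨ a = R.hi k) ∧ (x k - a) ^ 2 = R.axisDistSq k (x k) := by
    intro k
    rcases min_choice ((x k - R.lo k) ^ 2) ((x k - R.hi k) ^ 2) with h | h
    · exact ⟨_, Or.inl rfl, h.symm⟩
    · exact ⟨_, Or.inr rfl, h.symm⟩
  choose a ha ha' using this
  exact ⟨WithLp.toLp 2 a, ha, ha'⟩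

lemma infDist_sq (hkl : k ≠ l) (x : Plane) :
    Metric.infDist x R.corners ^ 2 = R.axisDistSq k (x k) + R.axisDistSq l (x l) := by
  obtain ⟨q, hq, hq'⟩ := R.exists_corner x
  rw [← hq', ← hq', ← Plane.dist_sq hkl]
  congr 1
  refine le_antisymm (Metric.infDist_le_dist_of_mem hq)
    ((Metric.le_infDist R.corners_nonempty).2 fun p hp => ?_)
  refine le_of_sq_le_sq ?_ dist_nonneg
  rw [Plane.dist_sq hkl, Plane.dist_sq hkl, hq', hq']
  exact add_le_add (R.axisDistSq_le hp _ _) (R.axisDistSq_le hp _ _)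

lemma sq_eq_axisDistSq {x q : Plane} (hq : q ∈ R.corners)
    (h : dist x q = Metric.infDist x R.corners) (k : Fin 2) :
    (x k - q k) ^ 2 = R.axisDistSq k (x k) := by
  obtain ⟨l, hkl⟩ := exists_ne k
  have h1 := R.infDist_sq hkl.symm x
  rw [← h, Plane.dist_sq hkl.symm] at h1
  linarith [R.axisDistSq_le hq k (x k), R.axisDistSq_le hq l (x l)]

lemma exists_eq_mid {x q q' : Plane} (hq : q ∈ R.corners) (hq' : q' ∈ R.corners) (hne : q ≠ q')
    (h : dist x q = Metric.infDist x R.corners) (h' : dist x q' = Metric.infDist x R.corners) :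
    ∃ k, x k = (R.lo k + R.hi k) / 2 := by
  obtain ⟨k, hk⟩ : ∃ k, q k ≠ q' k := by
    by_contra! hc
    exact hne (by ext k; exact hc k)
  refine ⟨k, ?_⟩
  have e := (R.sq_eq_axisDistSq hq h k).trans (R.sq_eq_axisDistSq hq' h' k).symm
  have hne' : q k - q' k ≠ 0 := sub_ne_zero.2 hk
  have hx : x k = (q k + q' k) / 2 := by
    have : (q k - q' k) * (2 * x k - (q k + q' k)) = 0 := by nlinarith
    rcases mul_eq_zero.1 this with h | h
    · exact absurd h hne'
    · linarith
  rcases hq k with h1 | h1 <;> rcases hq' k with h2 | h2 <;> rw [h1, h2] at hx hk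
  · exact absurd rfl hk
  · exact hx
  · rw [hx]; ring
  · exact absurd rfl hk

variable {R S}

/-- The slopes of `axisDistSq l` after subtracting `s ^ 2` are `-2 * lo` and `-2 * hi`, so the
difference for two separated intervals is strictly monotone. -/
lemma axisDistSq_sub_lt (h : R.hi l < S.lo l) {s t : ℝ} (hst : s < t) :
    S.axisDistSq l t - R.axisDistSq l t < S.axisDistSq l s - R.axisDistSq l s := by
  have hR := R.le l
  have hS := S.le l
  simp only [axisDistSq]
  rcases min_choice ((t - R.lo l) ^ 2) ((t - R.hi l) ^ 2) with e1 | e1 <;>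
  rcases min_choice ((s - S.lo l) ^ 2) ((s - S.hi l) ^ 2) with e2 | e2 <;> rw [e1, e2]
  · nlinarith [min_le_left ((t - S.lo l) ^ 2) ((t - S.hi l) ^ 2),
      min_le_left ((s - R.lo l) ^ 2) ((s - R.hi l) ^ 2)]
  · nlinarith [min_le_right ((t - S.lo l) ^ 2) ((t - S.hi l) ^ 2),
      min_le_left ((s - R.lo l) ^ 2) ((s - R.hi l) ^ 2)]
  · nlinarith [min_le_left ((t - S.lo l) ^ 2) ((t - S.hi l) ^ 2),
      min_le_right ((s - R.lo l) ^ 2) ((s - R.hi l) ^ 2)]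
  · nlinarith [min_le_right ((t - S.lo l) ^ 2) ((t - S.hi l) ^ 2),
      min_le_right ((s - R.lo l) ^ 2) ((s - R.hi l) ^ 2)]

lemma axisDistSq_mid_lt (h : R.hi k < S.lo k ∨ S.hi k < R.lo k) :
    R.axisDistSq k ((R.lo k + R.hi k) / 2) < S.axisDistSq k ((R.lo k + R.hi k) / 2) := by
  have hR := R.le k
  have hS := S.le k
  refine (min_le_left _ _).trans_lt (lt_min ?_ ?_) <;> rcases h with h | h <;> nlinarith

lemma axisDistSq_of_le_mid {s : ℝ} (h : s ≤ (R.lo l + R.hi l) / 2) :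
    R.axisDistSq l s = (s - R.lo l) ^ 2 :=
  min_eq_left (by nlinarith [R.le l])

lemma axisDistSq_of_mid_le {s : ℝ} (h : (R.lo l + R.hi l) / 2 ≤ s) :
    R.axisDistSq l s = (s - R.hi l) ^ 2 :=
  min_eq_right (by nlinarith [R.le l])

/-- `axisDistSq l t - (t - e) ^ 2` is a minimum of affine functions of `t`, hence concave; the sign
conditions say that `t` lies between `a` and `b` and differs from `b`. -/
lemma sq_lt_add_axisDistSq {c e a b t : ℝ} (h₁ : 0 < (b - t) * (b - a)) (h₂ : 0 ≤ (t - a) * (b - a))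
    (ha : (a - e) ^ 2 < c + S.axisDistSq l a) (hb : (b - e) ^ 2 ≤ c + S.axisDistSq l b) :
    (t - e) ^ 2 < c + S.axisDistSq l t := by
  have key : ∀ f : ℝ, (a - e) ^ 2 < c + (a - f) ^ 2 → (b - e) ^ 2 ≤ c + (b - f) ^ 2 →
      (t - e) ^ 2 < c + (t - f) ^ 2 := by
    intro f hfa hfb
    have h0 : (b - a) ^ 2 * (c + (t - f) ^ 2 - (t - e) ^ 2) =
        (b - t) * (b - a) * (c + (a - f) ^ 2 - (a - e) ^ 2) +
        (t - a) * (b - a) * (c + (b - f) ^ 2 - (b - e) ^ 2) := by ring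
    have h3 : 0 < (b - a) ^ 2 * (c + (t - f) ^ 2 - (t - e) ^ 2) := by
      rw [h0]
      exact add_pos_of_pos_of_nonneg (mul_pos h₁ (by linarith)) (mul_nonneg h₂ (by linarith))
    linarith [pos_of_mul_pos_right h3 (sq_nonneg _)]
  simp only [axisDistSq] at *
  rcases min_choice ((t - S.lo l) ^ 2) ((t - S.hi l) ^ 2) with h | h <;> rw [h]
  · exact key _ (ha.trans_le (by gcongr; exact min_le_left _ _))
      (hb.trans (by gcongr; exact min_le_left _ _))
  · exact key _ (ha.trans_le (by gcongr; exact min_le_right _ _))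
      (hb.trans (by gcongr; exact min_le_right _ _))

lemma axisDistSq_nonneg (s : ℝ) : 0 ≤ S.axisDistSq l s := le_min (sq_nonneg _) (sq_nonneg _)

lemma separated (h : Disjoint R.toSet S.toSet) : ∃ k, R.hi k < S.lo k ∨ S.hi k < R.lo k := by
  by_contra! hc
  have h₁ : (WithLp.toLp 2 fun k => max (R.lo k) (S.lo k) : Plane) ∈ R.toSet :=
    fun k => ⟨le_max_left _ _, max_le (R.le k) (hc k).1⟩
  exact Set.disjoint_left.1 h h₁ fun k => ⟨le_max_right _ _, max_le (hc k).2 (S.le k)⟩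

end AxisRect

open AxisRect

variable {n : ℕ}

/-! ### Points with two nearest corners in a farthest rectangle -/

/-- The points for which `R j` is a farthest rectangle, tied with another one, and has at least two
nearest corners. -/
def tieSet (R : Fin n → AxisRect) (j : Fin n) : Set Plane :=
  {w | (∃ q ∈ (R j).corners, ∃ q' ∈ (R j).corners, q ≠ q' ∧
      dist w q = Metric.infDist w (R j).corners ∧ dist w q' = Metric.infDist w (R j).corners) ∧
    (∀ i, Metric.infDist w (R i).corners ≤ Metric.infDist w (R j).corners) ∧
    ∃ i ≠ j, Metric.infDist w (R i).corners = Metric.infDist w (R j).corners}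

/-- The points on the line `x k = (lo k + hi k) / 2` of `R j` for which `R j` is farthest, tied with
some `R i` such that `p i` holds at the `l`-th coordinate. -/
def tieLine (R : Fin n → AxisRect) (j : Fin n) (k l : Fin 2) (p : Fin n → ℝ → Prop) :
    Set Plane :=
  {w | w k = ((R j).lo k + (R j).hi k) / 2 ∧
    (∀ i, Metric.infDist w (R i).corners ≤ Metric.infDist w (R j).corners) ∧
    ∃ i, p i (w l) ∧ Metric.infDist w (R i).corners = Metric.infDist w (R j).corners}

/-- If a tie with `R i` at `t` makes `R i` strictly farther than `R j` at every earlier point `s` in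
the order `r`, then there is at most one tie. Here `c` is the difference of the squared distances
in the `k`-th coordinate, constant along the line. -/
lemma tieLine_subsingleton {R : Fin n → AxisRect} {j : Fin n} {k l : Fin 2} (hkl : k ≠ l)
    {p : Fin n → ℝ → Prop} {r : ℝ → ℝ → Prop} (hr : ∀ s t, s ≠ t → r s t ∨ r t s)
    (h : ∀ i i' s t, r s t → p i' s → p i t → ∀ c,
      c = (R i).axisDistSq k (((R j).lo k + (R j).hi k) / 2) -
        (R j).axisDistSq k (((R j).lo k + (R j).hi k) / 2) →
      (R j).axisDistSq l t = c + (R i).axisDistSq l t →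
      (R j).axisDistSq l s < c + (R i).axisDistSq l s) :
    (tieLine R j k l p).Subsingleton := by
  have key : ∀ v ∈ tieLine R j k l p, ∀ w ∈ tieLine R j k l p, ¬ r (v l) (w l) := by
    rintro v ⟨hv, hvle, i', hi', -⟩ w ⟨hw, -, i, hi, hweq⟩ hvw
    have h1 := h i i' _ _ hvw hi' hi _ rfl (by
      have := congrArg (· ^ 2) hweq
      simp only [(R _).infDist_sq hkl, hw] at this
      linarith)
    have h2 := pow_le_pow_left₀ Metric.infDist_nonneg (hvle i) 2
    simp only [(R _).infDist_sq hkl, hv] at h2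
    linarith
  intro v hv w hw
  have hl : v l = w l := by
    by_contra hne
    rcases hr _ _ hne with h | h
    exacts [key v hv w hw h, key w hw v hv h]
  ext m
  by_cases hm : m = k
  · rw [hm, hv.1, hw.1]
  · obtain rfl : m = l := by
      clear h hr key hv hw hl
      fin_cases m <;> fin_cases k <;> fin_cases l <;> simp_all
    exact hl

lemma encard_tieLine_le {R : Fin n → AxisRect}
    (hR : Pairwise fun i j => Disjoint (R i).toSet (R j).toSet) {j : Fin n} {k l : Fin 2}
    (hkl : k ≠ l) : (tieLine R j k l fun i _ => i ≠ j).encard ≤ 6 := by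
  set lo := (R j).lo l with hlo
  set hi := (R j).hi l with hhi
  have hle : lo ≤ hi := (R j).le l
  set mid := (lo + hi) / 2 with hmid
  let sep : Fin n → Prop := fun i => (R j).hi k < (R i).lo k ∨ (R i).hi k < (R j).lo k
  -- at the heights `lo` and `hi` a rectangle separated in the other coordinate is strictly farther
  have hpos : ∀ i, sep i → ∀ s c,
      c = (R i).axisDistSq k (((R j).lo k + (R j).hi k) / 2) -
        (R j).axisDistSq k (((R j).lo k + (R j).hi k) / 2) →
      (s - s) ^ 2 < c + (R i).axisDistSq l s := by
    rintro i hsep s c rfl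
    have := axisDistSq_mid_lt hsep
    have := (R i).axisDistSq_nonneg (l := l) s
    rw [sub_self]
    linarith
  have s1 : (tieLine R j k l fun i _ => hi < (R i).lo l).Subsingleton := by
    refine tieLine_subsingleton hkl (r := (· < ·)) (fun s t h => h.lt_or_gt) ?_
    rintro i i' s t hst - hp c - e
    linarith [axisDistSq_sub_lt hp hst]
  have s2 : (tieLine R j k l fun i _ => (R i).hi l < lo).Subsingleton := by
    refine tieLine_subsingleton hkl (r := (· > ·)) (fun s t h => h.gt_or_lt) ?_
    rintro i i' s t hst - hp c - e
    linarith [axisDistSq_sub_lt hp hst]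
  have s3 : (tieLine R j k l fun i s => sep i ∧ s < lo).Subsingleton := by
    refine tieLine_subsingleton hkl (r := (· > ·)) (fun s t h => h.gt_or_lt) ?_
    rintro i i' s t hst ⟨-, hs⟩ ⟨hp, ht⟩ c hc e
    have hst : t < s := hst
    rw [axisDistSq_of_le_mid (by linarith)] at e ⊢
    exact sq_lt_add_axisDistSq (a := lo) (b := t) (by nlinarith) (by nlinarith)
      (hpos i hp lo c hc) e.le
  have s4 : (tieLine R j k l fun i s => sep i ∧ lo ≤ s ∧ s ≤ mid).Subsingleton := by
    refine tieLine_subsingleton hkl (r := (· < ·)) (fun s t h => h.lt_or_gt) ?_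
    rintro i i' s t hst ⟨-, hs⟩ ⟨hp, ht⟩ c hc e
    rw [axisDistSq_of_le_mid (by linarith)] at e ⊢
    exact sq_lt_add_axisDistSq (a := lo) (b := t) (by nlinarith) (by nlinarith)
      (hpos i hp lo c hc) e.le
  have s5 : (tieLine R j k l fun i s => sep i ∧ mid ≤ s ∧ s ≤ hi).Subsingleton := by
    refine tieLine_subsingleton hkl (r := (· > ·)) (fun s t h => h.gt_or_lt) ?_
    rintro i i' s t hst ⟨-, hs⟩ ⟨hp, ht⟩ c hc e
    have hst : t < s := hst
    rw [axisDistSq_of_mid_le (by linarith)] at e ⊢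
    exact sq_lt_add_axisDistSq (a := hi) (b := t) (by nlinarith) (by nlinarith)
      (hpos i hp hi c hc) e.le
  have s6 : (tieLine R j k l fun i s => sep i ∧ hi < s).Subsingleton := by
    refine tieLine_subsingleton hkl (r := (· < ·)) (fun s t h => h.lt_or_gt) ?_
    rintro i i' s t hst ⟨-, hs⟩ ⟨hp, ht⟩ c hc e
    rw [axisDistSq_of_mid_le (by linarith)] at e ⊢
    exact sq_lt_add_axisDistSq (a := hi) (b := t) (by nlinarith) (by nlinarith)
      (hpos i hp hi c hc) e.le
  have hsub : (tieLine R j k l fun i _ => i ≠ j) ⊆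
      (tieLine R j k l fun i _ => hi < (R i).lo l) ∪ (tieLine R j k l fun i _ => (R i).hi l < lo) ∪
      (tieLine R j k l fun i s => sep i ∧ s < lo) ∪
      (tieLine R j k l fun i s => sep i ∧ lo ≤ s ∧ s ≤ mid) ∪
      (tieLine R j k l fun i s => sep i ∧ mid ≤ s ∧ s ≤ hi) ∪
      (tieLine R j k l fun i s => sep i ∧ hi < s) := by
    rintro w ⟨hw, hwle, i, hij, he⟩
    obtain ⟨m, hm⟩ := separated (hR hij.symm)
    by_cases hmk : m = k
    · subst hmk
      rcases lt_or_ge (w l) lo with h1 | h1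
      · exact Or.inl (Or.inl (Or.inl (Or.inr ⟨hw, hwle, i, ⟨hm, h1⟩, he⟩)))
      rcases le_total (w l) mid with h2 | h2
      · exact Or.inl (Or.inl (Or.inr ⟨hw, hwle, i, ⟨hm, h1, h2⟩, he⟩))
      rcases lt_or_ge hi (w l) with h3 | h3
      · exact Or.inr ⟨hw, hwle, i, ⟨hm, h3⟩, he⟩
      · exact Or.inl (Or.inr ⟨hw, hwle, i, ⟨hm, h2, h3⟩, he⟩)
    · obtain rfl : m = l := by
        clear * - hmk hkl
        fin_cases m <;> fin_cases k <;> fin_cases l <;> simp_all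
      rcases hm with h | h
      · exact Or.inl (Or.inl (Or.inl (Or.inl (Or.inl ⟨hw, hwle, i, h, he⟩))))
      · exact Or.inl (Or.inl (Or.inl (Or.inl (Or.inr ⟨hw, hwle, i, h, he⟩))))
  refine (encard_le_encard hsub).trans ?_
  rw [← encard_le_one_iff_subsingleton] at s1 s2 s3 s4 s5 s6
  calc _ ≤ (1 + 1 + 1 + 1 + 1 + 1 : ℕ∞) :=
        (encard_union_le _ _).trans (add_le_add ((encard_union_le _ _).trans
          (add_le_add ((encard_union_le _ _).trans (add_le_add ((encard_union_le _ _).trans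
            (add_le_add ((encard_union_le _ _).trans (add_le_add s1 s2)) s3)) s4)) s5)) s6)
    _ = 6 := by norm_num

theorem encard_tieSet_le {R : Fin n → AxisRect}
    (hR : Pairwise fun i j => Disjoint (R i).toSet (R j).toSet) (j : Fin n) :
    (tieSet R j).encard ≤ 12 := by
  have hsub : tieSet R j ⊆
      (tieLine R j 0 1 fun i _ => i ≠ j) ∪ tieLine R j 1 0 fun i _ => i ≠ j := by
    rintro w ⟨⟨q, hq, q', hq', hne, h, h'⟩, hle, hex⟩
    obtain ⟨k, hk⟩ := (R j).exists_eq_mid hq hq' hne h h'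
    fin_cases k
    · exact Or.inl ⟨hk, hle, hex⟩
    · exact Or.inr ⟨hk, hle, hex⟩
  calc _ ≤ (6 + 6 : ℕ∞) := (encard_le_encard hsub).trans ((encard_union_le _ _).trans
        (add_le_add (encard_tieLine_le hR (by decide)) (encard_tieLine_le hR (by decide))))
    _ = 12 := by norm_num

/-! ### Leaving a region along a segment -/

section Pencil

variable {E α β : Type*} [AddCommGroup E] [Module ℝ E]

/-- Let `G` be the minimum over `j ∈ J` of the maximum of `f q` over `q ∈ Φ j`, and let `M` be the
maximum of `f q` over `q ∈ H`. If `M < 1 < G` at `z₀`, `1 < G` at `z₁`, `0 < G` on the segment from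
`z₀` to `z₁`, and `G` takes a value at most `1` there, then at some point of the segment, with
`m = G`, either `M = m`, or `M < m` and every `j` attaining the minimum attains its maximum
twice. -/
lemma exists_tight_of_not_forall (f : α → E →ₗ[ℝ] ℝ) (H : Finset α) (J : Finset β)
    (Φ : β → Finset α) (hΦ : ∀ j, (Φ j).Nonempty) {z₀ z₁ : E}
    (hH : ∀ q ∈ H, f q z₀ < 1)
    (hG₀ : ∀ j ∈ J, ∃ q ∈ Φ j, 1 < f q z₀) (hG₁ : ∀ j ∈ J, ∃ q ∈ Φ j, 1 < f q z₁)
    (hpos : ∀ t ∈ Icc (0 : ℝ) 1, ∀ j ∈ J, ∃ q ∈ Φ j, 0 < f q (z₀ + t • (z₁ - z₀)))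
    (hno : ∃ t ∈ Icc (0 : ℝ) 1, ∃ j ∈ J, ∀ q ∈ Φ j, f q (z₀ + t • (z₁ - z₀)) ≤ 1) :
    ∃ t ∈ Icc (0 : ℝ) 1, ∃ m > 0,
      (∀ j ∈ J, ∃ q ∈ Φ j, m ≤ f q (z₀ + t • (z₁ - z₀))) ∧
      (∃ j ∈ J, ∀ q ∈ Φ j, f q (z₀ + t • (z₁ - z₀)) ≤ m) ∧
      (∀ q ∈ H, f q (z₀ + t • (z₁ - z₀)) ≤ m) ∧
      ((∃ q ∈ H, f q (z₀ + t • (z₁ - z₀)) = m) ∨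
        ((∀ q ∈ H, f q (z₀ + t • (z₁ - z₀)) < m) ∧
          ∀ j ∈ J, (∀ q ∈ Φ j, f q (z₀ + t • (z₁ - z₀)) ≤ m) →
            ∃ q ∈ Φ j, ∃ q' ∈ Φ j, q ≠ q' ∧ f q (z₀ + t • (z₁ - z₀)) = m ∧
              f q' (z₀ + t • (z₁ - z₀)) = m)) := by
  obtain ⟨t₁, ht₁, j₁, hj₁, hle₁⟩ := hno
  have hJ : J.Nonempty := ⟨j₁, hj₁⟩
  set φ : α → ℝ → ℝ := fun q t => f q (z₀ + t • (z₁ - z₀)) with hφ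
  have hφ' : ∀ q t, f q (z₀ + t • (z₁ - z₀)) = φ q t := fun _ _ => rfl
  simp only [hφ'] at hpos hle₁ ⊢
  have haff : ∀ q t, φ q t = f q z₀ + t * (f q z₁ - f q z₀) := by
    intro q t
    simp [hφ]
  have hcont : ∀ q, Continuous (φ q) := by
    intro q
    simp only [funext (haff q)]
    fun_prop
  have e0 : ∀ q, φ q 0 = f q z₀ := by intro q; simp [haff]
  have e1 : ∀ q, φ q 1 = f q z₁ := by intro q; simp [haff]
  let G : ℝ → ℝ := fun t => J.inf' hJ fun j => (Φ j).sup' (hΦ j) fun q => φ q t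
  have hGc : Continuous G := Continuous.finset_inf'_apply hJ fun j _ =>
    Continuous.finset_sup'_apply (hΦ j) fun q _ => hcont q
  have hlt : ∀ a t, a < G t ↔ ∀ j ∈ J, ∃ q ∈ Φ j, a < φ q t := by
    intro a t
    simp only [G, Finset.lt_inf'_iff, Finset.lt_sup'_iff]
  have hle : ∀ a t, G t ≤ a ↔ ∃ j ∈ J, ∀ q ∈ Φ j, φ q t ≤ a := by
    intro a t
    simp only [G, Finset.inf'_le_iff, Finset.sup'_le_iff]
  have hle' : ∀ a t, a ≤ G t ↔ ∀ j ∈ J, ∃ q ∈ Φ j, a ≤ φ q t := by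
    intro a t
    simp only [G, Finset.le_inf'_iff, Finset.le_sup'_iff]
  have hGpos : ∀ t ∈ Icc (0 : ℝ) 1, 0 < G t := fun t ht => (hlt _ _).2 (hpos t ht)
  have hG0 : 1 < G 0 := (hlt _ _).2 (by simpa only [e0] using hG₀)
  have hG1 : 1 < G 1 := (hlt _ _).2 (by simpa only [e1] using hG₁)
  -- if `M` reaches `G` somewhere, they agree at some point by the intermediate value theorem
  by_cases hcase : ∃ q ∈ H, ∃ t ∈ Icc (0 : ℝ) 1, G t ≤ φ q t
  · obtain ⟨q, hq, t, ht, hqt⟩ := hcase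
    have hHne : H.Nonempty := ⟨q, hq⟩
    let M : ℝ → ℝ := fun t => H.sup' hHne fun q => φ q t
    have hMc : Continuous M := Continuous.finset_sup'_apply hHne fun q _ => hcont q
    have h0 : G 0 - M 0 ∈ Ici 0 := by
      have : M 0 < 1 := (Finset.sup'_lt_iff _).2 fun q hq => by rw [e0]; exact hH q hq
      simp only [mem_Ici]; linarith
    have ht0 : G t - M t ≤ 0 := by
      have : φ q t ≤ M t := Finset.le_sup' (fun q => φ q t) hq
      linarith
    obtain ⟨s, hs, hs'⟩ := intermediate_value_Icc' ht.1 (hGc.sub hMc).continuousOn ⟨ht0, h0⟩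
    have hs1 : s ∈ Icc (0 : ℝ) 1 := ⟨hs.1, hs.2.trans ht.2⟩
    have hGM : M s = G s := (sub_eq_zero.1 hs').symm
    refine ⟨s, hs1, G s, hGpos s hs1, (hle' _ _).1 le_rfl, (hle _ _).1 le_rfl, ?_, Or.inl ?_⟩
    · intro q hq
      rw [← hGM]
      exact Finset.le_sup' (fun q => φ q s) hq
    · obtain ⟨q, hq, hq'⟩ := Finset.exists_mem_eq_sup' hHne fun q => φ q s
      exact ⟨q, hq, by rw [← hGM, ← hq']⟩
  · push Not at hcase
    obtain ⟨t', ht', hmin⟩ := isCompact_Icc.exists_isMinOn (nonempty_Icc.2 zero_le_one)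
      hGc.continuousOn (s := Icc (0 : ℝ) 1)
    have hmin : ∀ t ∈ Icc (0 : ℝ) 1, G t' ≤ G t := hmin
    set m := G t' with hm
    have hm1 : m ≤ 1 := (hmin t₁ ht₁).trans ((hle _ _).2 ⟨j₁, hj₁, hle₁⟩)
    have hcomp : IsCompact (Icc (0 : ℝ) 1 ∩ {t | G t ≤ m}) :=
      isCompact_Icc.inter_right (isClosed_le hGc continuous_const)
    -- the last point at which `G` attains its minimum
    obtain ⟨t, ⟨ht, htm⟩, hgreat⟩ := hcomp.exists_isGreatest ⟨t', ht', (le_refl m : G t' ≤ m)⟩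
    have htm : G t = m := le_antisymm htm (hmin t ht)
    have ht0 : 0 < t := ht.1.lt_of_ne (by rintro rfl; linarith)
    have ht1 : t < 1 := ht.2.lt_of_ne (by rintro rfl; linarith)
    refine ⟨t, ht, m, hGpos t' ht', (hle' _ _).1 htm.ge, (hle _ _).1 htm.le,
      fun q hq => (htm ▸ hcase q hq t ht).le, Or.inr ⟨fun q hq => htm ▸ hcase q hq t ht, ?_⟩⟩
    intro j hj hjle
    obtain ⟨q, hq, hqm⟩ := (hle' _ _).1 htm.ge j hj
    have hqm : φ q t = m := le_antisymm (hjle q hq) hqm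
    by_contra! hun
    -- near `t` the function `φ q` bounds `G` from above; being affine and at least `m`, it is
    -- constant, so that `G` attains its minimum beyond `t`
    have hev : ∀ᶠ s in 𝓝 t, ∀ q' ∈ Φ j, φ q' s ≤ φ q s := by
      rw [eventually_all_finset]
      intro q' hq'
      by_cases hqq : q = q'
      · exact Eventually.of_forall fun s => by rw [hqq]
      · have hlt' : φ q' t < φ q t := by
          rw [hqm]
          exact (hjle q' hq').lt_of_ne (hun q hq q' hq' hqq hqm)
        filter_upwards [(hcont q').continuousAt.eventually_lt (hcont q).continuousAt hlt'] with s hs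
          using hs.le
    have hev2 : ∀ᶠ s in 𝓝 t, G s ≤ φ q s ∧ s ∈ Icc (0 : ℝ) 1 := by
      filter_upwards [hev, Icc_mem_nhds ht0 ht1] with s hs hs'
      exact ⟨(hle _ _).2 ⟨j, hj, hs⟩, hs'⟩
    obtain ⟨a, ⟨ha, ha'⟩, hat⟩ := ((hev2.filter_mono nhdsWithin_le_nhds).and
      (self_mem_nhdsWithin (a := t) (s := Iio t))).exists
    obtain ⟨b, ⟨hb, hb'⟩, hbt⟩ := ((hev2.filter_mono nhdsWithin_le_nhds).and
      (self_mem_nhdsWithin (a := t) (s := Ioi t))).exists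
    have hat : a < t := hat
    have hbt : t < b := hbt
    have h1 := (hmin a ha').trans ha
    have h2 := (hmin b hb').trans hb
    rw [haff] at h1 h2 hqm hb
    have hslope : f q z₁ - f q z₀ = 0 := by
      apply le_antisymm <;> nlinarith
    rw [hslope] at hqm hb
    have := hgreat ⟨hb', show G b ≤ m by linarith⟩
    linarith

end Pencil

/-- The linear form of `z` that equals `1` where `p + z` is equidistant from `p` and `q`. It is zero
for `q = p`. -/
noncomputable def bisectorFun (p q : Plane) : Plane →ₗ[ℝ] ℝ :=
  (2 / ‖q - p‖ ^ 2) • (innerₗ Plane (q - p))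

section Bisector

variable {p q z : Plane}

lemma bisectorFun_apply : bisectorFun p q z = 2 / ‖q - p‖ ^ 2 * inner ℝ (q - p) z := rfl

lemma dist_sq_sub_dist_sq (h : q ≠ p) :
    dist (p + z) p ^ 2 - dist (p + z) q ^ 2 = ‖q - p‖ ^ 2 * (bisectorFun p q z - 1) := by
  have hpos : ‖q - p‖ ^ 2 ≠ 0 := pow_ne_zero 2 (norm_ne_zero_iff.2 (sub_ne_zero.2 h))
  have : p + z - q = z - (q - p) := by abel
  rw [dist_self_add_left, dist_eq_norm, this, norm_sub_sq_real, bisectorFun_apply,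
    real_inner_comm]
  generalize ‖q - p‖ ^ 2 = d at hpos ⊢
  field_simp
  ring

lemma dist_lt_dist_iff (h : q ≠ p) :
    dist (p + z) q < dist (p + z) p ↔ 1 < bisectorFun p q z := by
  have h1 := dist_sq_sub_dist_sq (z := z) h
  have hpos : 0 < ‖q - p‖ ^ 2 := pow_pos (norm_pos_iff.2 (sub_ne_zero.2 h)) 2
  rw [← sq_lt_sq₀ dist_nonneg dist_nonneg, ← sub_pos, h1, mul_pos_iff_of_pos_left hpos, sub_pos]

lemma dist_lt_dist_iff' (h : q ≠ p) :
    dist (p + z) p < dist (p + z) q ↔ bisectorFun p q z < 1 := by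
  have h1 := dist_sq_sub_dist_sq (z := z) h
  have hpos : 0 < ‖q - p‖ ^ 2 := pow_pos (norm_pos_iff.2 (sub_ne_zero.2 h)) 2
  rw [← sq_lt_sq₀ dist_nonneg dist_nonneg, ← sub_neg, h1, ← sub_neg (b := (1 : ℝ)), ← neg_pos,
    ← mul_neg, mul_pos_iff_of_pos_left hpos, neg_pos]

lemma dist_eq_dist_iff (h : q ≠ p) :
    dist (p + z) q = dist (p + z) p ↔ bisectorFun p q z = 1 := by
  have h1 := dist_lt_dist_iff (z := z) h
  have h2 := dist_lt_dist_iff' (z := z) h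
  rw [le_antisymm_iff, le_antisymm_iff, ← not_lt, ← not_lt, ← not_lt, ← not_lt, h1, h2,
    and_comm]

end Bisector

open FCVD

/-! ### Regions of the corners -/

/-- The clusters of the diagram. -/
abbrev cornerSets (R : Fin n → AxisRect) (i : Fin n) : Set Plane := (R i).corners

namespace AxisRect

lemma exists_infDist_eq (R : AxisRect) (x : Plane) :
    ∃ q ∈ R.corners, Metric.infDist x R.corners = dist x q := 
  (R.corners_finite.isCompact).exists_infDist_eq_dist R.corners_nonempty x

lemma ne_of_mem_corners {R S : AxisRect} (h : Disjoint R.toSet S.toSet) {p q : Plane}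
    (hp : p ∈ R.corners) (hq : q ∈ S.corners) : q ≠ p := by
  have hsub : ∀ T : AxisRect, T.corners ⊆ T.toSet := by
    intro T x hx k
    rcases hx k with h | h <;> rw [h]
    exacts [⟨le_rfl, T.le k⟩, ⟨T.le k, le_rfl⟩]
  exact fun e => Set.disjoint_left.1 h (hsub R hp) (hsub S (e ▸ hq))

end AxisRect

section Region

variable {R : Fin n → AxisRect} {s : Σ i, cornerSets R i} {x : Plane}

lemma infDist_eq_of_nearest {i : Fin n} {p : Plane} (hp : p ∈ (R i).corners)
    (h : ∀ q ∈ (R i).corners, q ≠ p → dist x p < dist x q) :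
    Metric.infDist x (R i).corners = dist x p := by
  refine le_antisymm (Metric.infDist_le_dist_of_mem hp)
    ((Metric.le_infDist (R i).corners_nonempty).2 fun q hq => ?_)
  by_cases hqp : q = p
  · rw [hqp]
  · exact (h q hq hqp).le

lemma mem_region_iff : x ∈ region (cornerSets R) s ↔
    (∀ q ∈ (R s.1).corners, q ≠ s.2 → dist x s.2 < dist x q) ∧
    ∀ j, j ≠ s.1 → ∃ q ∈ (R j).corners, dist x q < dist x s.2 := by
  constructor
  · rintro ⟨h1, h2⟩
    refine ⟨h2, fun j hj => ?_⟩
    have := h1 j hj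
    rwa [infDist_eq_of_nearest s.2.2 h2, Metric.infDist_lt_iff (R j).corners_nonempty] at this
  · rintro ⟨h1, h2⟩
    refine ⟨fun j hj => ?_, h1⟩
    rw [infDist_eq_of_nearest s.2.2 h1, Metric.infDist_lt_iff (R j).corners_nonempty]
    exact h2 j hj

lemma isOpen_region (s : Σ i, cornerSets R i) : IsOpen (region (cornerSets R) s) := by
  have : region (cornerSets R) s =
      (⋂ q ∈ (R s.1).corners, {x | q ≠ (s.2 : Plane) → dist x (s.2 : Plane) < dist x q}) ∩
      ⋂ j, ⋃ q ∈ (R j).corners, {x | j ≠ s.1 → dist x q < dist x (s.2 : Plane)} := by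
    ext x
    rw [mem_region_iff]
    simp only [mem_inter_iff, mem_iInter, mem_iUnion, mem_ofPred_eq, exists_prop]
    refine and_congr Iff.rfl (forall_congr' fun j => ?_)
    by_cases hj : j = s.1
    · simpa [hj, Set.Nonempty] using (R s.1).corners_nonempty
    · simp [hj]
  rw [this]
  refine ((R s.1).corners_finite.isOpen_biInter fun q _ => ?_).inter
    (isOpen_iInter_of_finite fun j => isOpen_biUnion fun q _ => ?_)
  · by_cases h : q = s.2
    · simp [h]
    · simp only [ne_eq, h, not_false_eq_true, forall_const]
      exact isOpen_lt (by fun_prop) (by fun_prop)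
  · by_cases h : j = s.1
    · simp [h]
    · simp only [ne_eq, h, not_false_eq_true, forall_const]
      exact isOpen_lt (by fun_prop) (by fun_prop)

lemma eq_of_mem_region {s s' : Σ i, cornerSets R i} (h : x ∈ region (cornerSets R) s)
    (h' : x ∈ region (cornerSets R) s') : s = s' := by
  obtain ⟨i, p⟩ := s
  obtain ⟨i', p'⟩ := s'
  obtain rfl : i = i' := by
    by_contra hne
    exact lt_asymm (h.1 i' (Ne.symm hne)) (h'.1 i hne)
  obtain rfl : p = p' := by
    by_contra hne
    have hne' : (p : Plane) ≠ p' := fun e => hne (Subtype.ext e)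
    exact lt_asymm (h.2 p' p'.2 hne'.symm) (h'.2 p p.2 hne')
  rfl

lemma add_mem_region_iff (hR : Pairwise fun i j => Disjoint (R i).toSet (R j).toSet) {z : Plane} :
    (s.2 : Plane) + z ∈ region (cornerSets R) s ↔
    (∀ q ∈ (R s.1).corners, q ≠ s.2 → bisectorFun s.2 q z < 1) ∧
    ∀ j, j ≠ s.1 → ∃ q ∈ (R j).corners, 1 < bisectorFun s.2 q z := by
  rw [mem_region_iff]
  refine and_congr (forall₃_congr fun q _ hq => dist_lt_dist_iff' hq)
    (forall₂_congr fun j hj => exists_congr fun q => and_congr_right fun hq =>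
      dist_lt_dist_iff (AxisRect.ne_of_mem_corners (hR hj.symm) s.2.2 hq))

lemma closure_region_subset (hR : Pairwise fun i j => Disjoint (R i).toSet (R j).toSet) {z : Plane}
    (hz : (s.2 : Plane) + z ∈ closure (region (cornerSets R) s)) :
    (∀ q ∈ (R s.1).corners, q ≠ s.2 → bisectorFun s.2 q z ≤ 1) ∧
    ∀ j, j ≠ s.1 → ∃ q ∈ (R j).corners, 1 ≤ bisectorFun s.2 q z := by
  have hc : ∀ q, Continuous fun x : Plane => bisectorFun s.2 q (x - s.2) := fun q =>
    (bisectorFun s.2 q).continuous_of_finiteDimensional.comp (by fun_prop)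
  have hcl : IsClosed ((⋂ q ∈ (R s.1).corners,
        {x : Plane | q ≠ s.2 → bisectorFun s.2 q (x - s.2) ≤ 1}) ∩
      ⋂ j, ⋃ q ∈ (R j).corners, {x : Plane | j ≠ s.1 → 1 ≤ bisectorFun s.2 q (x - s.2)}) := by
    refine (isClosed_biInter fun q _ => ?_).inter (isClosed_iInter fun j =>
      (R j).corners_finite.isClosed_biUnion fun q _ => ?_)
    · by_cases h : q = s.2
      · simp [h]
      · simp only [ne_eq, h, not_false_eq_true, forall_const]
        exact isClosed_le (hc q) continuous_const
    · by_cases h : j = s.1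
      · simp [h]
      · simp only [ne_eq, h, not_false_eq_true, forall_const]
        exact isClosed_le continuous_const (hc q)
  have hsub := closure_minimal (s := region (cornerSets R) s) (fun x hx => ?_) hcl hz
  · simp only [mem_inter_iff, mem_iInter, mem_iUnion, mem_ofPred_eq, exists_prop,
      add_sub_cancel_left] at hsub
    exact ⟨hsub.1, fun j hj => (hsub.2 j).imp fun q hq => ⟨hq.1, hq.2 hj⟩⟩
  · rw [← add_sub_cancel (s.2 : Plane) x, add_mem_region_iff hR] at hx
    simp only [mem_inter_iff, mem_iInter, mem_iUnion, mem_ofPred_eq, exists_prop]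
    refine ⟨fun q hq hqp => (hx.1 q hq hqp).le, fun j => ?_⟩
    by_cases hj : j = s.1
    · exact ⟨_, (R j).corners_nonempty.some_mem, fun h => absurd hj h⟩
    · obtain ⟨q, hq, hq'⟩ := hx.2 j hj
      exact ⟨q, hq, fun _ => hq'.le⟩

/-- If `p + z` is interior to the closure, then the inequalities hold weakly at `p + r • z` for `r`
slightly larger and slightly smaller than `1`, hence strictly at `p + z`. -/
lemma interior_closure_region_subset (hR : Pairwise fun i j => Disjoint (R i).toSet (R j).toSet)
    (s : Σ i, cornerSets R i) :
    interior (closure (region (cornerSets R) s)) ⊆ region (cornerSets R) s := by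
  intro x hx
  obtain ⟨z, rfl⟩ : ∃ z, x = (s.2 : Plane) + z := ⟨x - s.2, by abel⟩
  have hev : ∀ᶠ r : ℝ in 𝓝 1, (s.2 : Plane) + r • z ∈ closure (region (cornerSets R) s) :=
    (Continuous.tendsto (f := fun r : ℝ => (s.2 : Plane) + r • z) (by fun_prop) 1).eventually
      (by simpa using mem_interior_iff_mem_nhds.1 hx)
  obtain ⟨a, ⟨ha, ha0⟩, ha1⟩ := (((hev.and (lt_mem_nhds zero_lt_one)).filter_mono
    nhdsWithin_le_nhds).and (self_mem_nhdsWithin (a := (1 : ℝ)) (s := Iio 1))).exists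
  obtain ⟨b, hb, hb1⟩ := ((hev.filter_mono nhdsWithin_le_nhds).and
    (self_mem_nhdsWithin (a := (1 : ℝ)) (s := Ioi 1))).exists
  have ha1 : a < 1 := ha1
  have hb1 : 1 < b := hb1
  rw [add_mem_region_iff hR]
  refine ⟨fun q hq hqp => ?_, fun j hj => ?_⟩
  · have := (closure_region_subset hR hb).1 q hq hqp
    rw [map_smul, smul_eq_mul] at this
    nlinarith
  · obtain ⟨q, hq, hq'⟩ := (closure_region_subset hR ha).2 j hj
    refine ⟨q, hq, ?_⟩
    rw [map_smul, smul_eq_mul] at hq'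
    nlinarith

end Region

/-- The points for which the cluster of `s` is a farthest one, tied with another one, and has the
unique nearest point `s.2`, while every other farthest cluster has at least two nearest points. -/
def cutSet (R : Fin n → AxisRect) (s : Σ i, cornerSets R i) : Set Plane :=
  {w | (∀ q ∈ (R s.1).corners, q ≠ s.2 → dist w s.2 < dist w q) ∧
    (∀ j, Metric.infDist w (R j).corners ≤ dist w s.2) ∧
    (∃ j ≠ s.1, Metric.infDist w (R j).corners = dist w s.2) ∧
    ∀ j ≠ s.1, Metric.infDist w (R j).corners = dist w s.2 →
      ∃ q ∈ (R j).corners, ∃ q' ∈ (R j).corners, q ≠ q' ∧ dist w q = dist w s.2 ∧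
        dist w q' = dist w s.2}

/-! ### Segments within a quadrant -/

/-- The sign `1` or `-1`. -/
def boolSign (b : Bool) : ℝ := if b then 1 else -1

/-- The open quadrant with the given signs of the coordinates. -/
def quadrant (σ : Fin 2 → Bool) : Set Plane := {z | ∀ k, 0 < boolSign (σ k) * z k}

lemma convex_quadrant (σ : Fin 2 → Bool) : Convex ℝ (quadrant σ) := by
  intro x hx y hy a b ha hb hab k
  have e : boolSign (σ k) * (a • x + b • y) k =
      a * (boolSign (σ k) * x k) + b * (boolSign (σ k) * y k) := by
    simp; ring
  rw [e]
  rcases ha.lt_or_eq with ha | rfl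
  · exact add_pos_of_pos_of_nonneg (mul_pos ha (hx k)) (mul_nonneg hb (hy k).le)
  · obtain rfl : b = 1 := by linarith
    simpa using hy k

lemma isOpen_quadrant (σ : Fin 2 → Bool) : IsOpen (quadrant σ) := by
  simp only [quadrant, ofPred_forall]
  exact isOpen_iInter_of_finite fun k => isOpen_lt (by fun_prop) (by fun_prop)

lemma AxisRect.exists_corner_forall_quadrant (R : AxisRect) (σ : Fin 2 → Bool) :
    ∃ q ∈ R.corners, ∀ p ∈ R.corners, ∀ z ∈ quadrant σ,
      (inner ℝ p z : ℝ) ≤ inner ℝ q z := by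
  refine ⟨WithLp.toLp 2 fun k => if σ k then R.hi k else R.lo k, fun k => ?_, ?_⟩
  · cases h : σ k <;> simp [h]
  · intro p hp z hz
    simp only [PiLp.inner_apply, RCLike.inner_apply, conj_trivial]
    refine Finset.sum_le_sum fun k _ => ?_
    have h1 := hz k
    have h2 := R.le k
    rcases hp k with h | h <;> cases hk : σ k <;> simp [hk, boolSign, h] at h1 ⊢ <;> nlinarith

/-- In a fixed quadrant one corner of `R` decides whether some `bisectorFun p q` is positive, so
positivity at the endpoints of a segment extends to the segment. -/
lemma exists_bisectorFun_pos {R : AxisRect} {σ : Fin 2 → Bool} {p z₀ z₁ z : Plane}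
    (hp : ∀ q ∈ R.corners, q ≠ p)
    (h₀ : z₀ ∈ quadrant σ) (h₁ : z₁ ∈ quadrant σ) (hz : z ∈ segment ℝ z₀ z₁)
    (hq₀ : ∃ q ∈ R.corners, 0 < bisectorFun p q z₀)
    (hq₁ : ∃ q ∈ R.corners, 0 < bisectorFun p q z₁) :
    ∃ q ∈ R.corners, 0 < bisectorFun p q z := by
  obtain ⟨q, hq, hmax⟩ := R.exists_corner_forall_quadrant σ
  have hiff : ∀ q ∈ R.corners, ∀ z, 0 < bisectorFun p q z ↔ 0 < (inner ℝ (q - p) z : ℝ) := by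
    intro q hq z
    have hpos : 0 < 2 / ‖q - p‖ ^ 2 :=
      div_pos two_pos (pow_pos (norm_pos_iff.2 (sub_ne_zero.2 (hp q hq))) 2)
    rw [bisectorFun_apply, mul_pos_iff_of_pos_left hpos]
  have key : ∀ z ∈ quadrant σ, (∃ q ∈ R.corners, 0 < bisectorFun p q z) →
      0 < (inner ℝ (q - p) z : ℝ) := by
    rintro z hz ⟨q', hq', h⟩
    rw [hiff q' hq', inner_sub_left] at h
    rw [inner_sub_left]
    linarith [hmax q' hq' z hz]
  refine ⟨q, hq, (hiff q hq z).2 ?_⟩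
  have hconv : Convex ℝ {z : Plane | 0 < (inner ℝ (q - p) z : ℝ)} :=
    convex_halfSpace_gt (innerₗ Plane (q - p)).isLinear 0
  exact hconv.segment_subset (key z₀ h₀ hq₀) (key z₁ h₁ hq₁) hz

/-- If a segment within a quadrant at the corner `s.2` leaves the region of `s`, then the ray from
the corner through some point of the segment hits `tieSet` or `cutSet`. -/
lemma exists_separator {R : Fin n → AxisRect}
    (hR : Pairwise fun i j => Disjoint (R i).toSet (R j).toSet) {s : Σ i, cornerSets R i}
    {σ : Fin 2 → Bool} {z₀ z₁ : Plane} (h₀ : z₀ ∈ quadrant σ) (h₁ : z₁ ∈ quadrant σ)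
    (hr₀ : (s.2 : Plane) + z₀ ∈ region (cornerSets R) s)
    (hr₁ : (s.2 : Plane) + z₁ ∈ region (cornerSets R) s) {z : Plane} (hz : z ∈ segment ℝ z₀ z₁)
    (hzr : (s.2 : Plane) + z ∉ region (cornerSets R) s) :
    ∃ z' ∈ segment ℝ z₀ z₁, ∃ m > (0 : ℝ),
      (s.2 : Plane) + m⁻¹ • z' ∈ tieSet R s.1 ∪ cutSet R s := by
  classical
  obtain ⟨i, p, hp⟩ := s
  simp only at *
  have hne : ∀ j ≠ i, ∀ q ∈ (R j).corners, q ≠ p := fun j hj q hq =>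
    AxisRect.ne_of_mem_corners (hR hj.symm) hp hq
  rw [add_mem_region_iff hR] at hr₀ hr₁ hzr
  simp only at hr₀ hr₁ hzr
  have hseg : ∀ t ∈ Icc (0 : ℝ) 1, z₀ + t • (z₁ - z₀) ∈ segment ℝ z₀ z₁ := by
    intro t ht
    rw [segment_eq_image']
    exact ⟨t, ht, rfl⟩
  obtain ⟨t, ht, rfl⟩ := (segment_eq_image' ℝ z₀ z₁ ▸ hz :
    z ∈ (fun θ : ℝ => z₀ + θ • (z₁ - z₀)) '' Icc 0 1)
  obtain ⟨t', ht', m, hm, c1, c2, c3, c4⟩ := exists_tight_of_not_forall (bisectorFun p)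
    ((R i).corners_finite.toFinset.erase p) (Finset.univ.erase i)
    (fun j => (R j).corners_finite.toFinset) (fun j => by simpa using (R j).corners_nonempty)
    (z₀ := z₀) (z₁ := z₁)
    (by simpa using fun q hqp hq => hr₀.1 q hq hqp)
    (by simpa using hr₀.2) (by simpa using hr₁.2)
    (by
      intro t ht j hj
      have hj : j ≠ i := by simpa using hj
      obtain ⟨q, hq, hq'⟩ := exists_bisectorFun_pos (hne j hj) h₀ h₁ (hseg t ht)
        ((hr₀.2 j hj).imp fun q hq => ⟨hq.1, one_pos.trans hq.2⟩)
        ((hr₁.2 j hj).imp fun q hq => ⟨hq.1, one_pos.trans hq.2⟩)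
      exact ⟨q, by simpa using hq, hq'⟩)
    (by
      have hH : ∀ q ∈ (R i).corners, q ≠ p → bisectorFun p q (z₀ + t • (z₁ - z₀)) < 1 := by
        intro q hq hqp
        exact (convex_halfSpace_lt (bisectorFun p q).isLinear 1).segment_subset
          (hr₀.1 q hq hqp) (hr₁.1 q hq hqp) hz
      obtain ⟨j, hj, hj'⟩ : ∃ j, j ≠ i ∧ ∀ q ∈ (R j).corners,
          bisectorFun p q (z₀ + t • (z₁ - z₀)) ≤ 1 := by
        by_contra! hc
        exact hzr ⟨hH, hc⟩
      exact ⟨t, ht, j, by simpa using hj, by simpa using hj'⟩)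
  refine ⟨_, hseg t' ht', m, hm, ?_⟩
  simp only [Finset.mem_erase, Finset.mem_univ, and_true, Set.Finite.mem_toFinset,
    and_imp] at c1 c2 c3 c4
  set z' := z₀ + t' • (z₁ - z₀) with hz'
  set w := p + m⁻¹ • z' with hw
  have hval : ∀ q, bisectorFun p q (m⁻¹ • z') = m⁻¹ * bisectorFun p q z' := fun q => by simp
  have hm1 : m⁻¹ * m = 1 := inv_mul_cancel₀ hm.ne'
  have hmpos : 0 < m⁻¹ := inv_pos.2 hm
  have dlt : ∀ q, q ≠ p → (dist w p < dist w q ↔ bisectorFun p q z' < m) := by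
    intro q hq
    rw [hw, dist_lt_dist_iff' hq, hval, ← hm1, mul_lt_mul_iff_right₀ hmpos]
  have dgt : ∀ q, q ≠ p → (dist w q < dist w p ↔ m < bisectorFun p q z') := by
    intro q hq
    rw [hw, dist_lt_dist_iff hq, hval, ← hm1, mul_lt_mul_iff_right₀ hmpos]
  have deq : ∀ q, q ≠ p → bisectorFun p q z' = m → dist w q = dist w p := by
    intro q hq h
    rw [hw, dist_eq_dist_iff hq, hval, h, hm1]
  -- the circle about `w` through `p` meets every cluster
  have hle : ∀ j ≠ i, Metric.infDist w (R j).corners ≤ dist w p := by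
    intro j hj
    obtain ⟨q, hq, hq'⟩ := c1 j hj
    refine (Metric.infDist_le_dist_of_mem hq).trans (not_lt.1 fun h => ?_)
    exact absurd ((dlt q (hne j hj q hq)).1 h) (not_lt.2 hq')
  have hge : ∀ j ≠ i, (∀ q ∈ (R j).corners, bisectorFun p q z' ≤ m) →
      Metric.infDist w (R j).corners = dist w p := by
    intro j hj h
    refine le_antisymm (hle j hj) ((Metric.le_infDist (R j).corners_nonempty).2 fun q hq => ?_)
    exact not_lt.1 fun h' => absurd ((dgt q (hne j hj q hq)).1 h') (not_lt.2 (h q hq))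
  obtain ⟨j, hj, hjle⟩ := c2
  have hown : ∀ q ∈ (R i).corners, dist w p ≤ dist w q := by
    intro q hq
    by_cases hqp : q = p
    · rw [hqp]
    · exact not_lt.1 fun h => absurd ((dgt q hqp).1 h) (not_lt.2 (c3 q hqp hq))
  have hi : Metric.infDist w (R i).corners = dist w p :=
    le_antisymm (Metric.infDist_le_dist_of_mem hp)
      ((Metric.le_infDist (R i).corners_nonempty).2 hown)
  have hall : ∀ k, Metric.infDist w (R k).corners ≤ dist w p := by
    intro k
    by_cases hk : k = i
    · rw [hk, hi]
    · exact hle k hk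
  rcases c4 with ⟨q, ⟨hqp, hq⟩, hqm⟩ | ⟨c4, c5⟩
  · left
    refine ⟨⟨p, hp, q, hq, hqp.symm, hi.symm, hi ▸ deq q hqp hqm⟩, fun k => hi ▸ hall k, j, hj, ?_⟩
    rw [hi, hge j hj hjle]
  · right
    refine ⟨fun q hq hqp => (dlt q hqp).2 (c4 q hqp hq), hall, ⟨j, hj, hge j hj hjle⟩, ?_⟩
    intro k hk hk'
    obtain ⟨q, hq, q', hq', h1, h2, h3⟩ := c5 k hk fun q hq => not_lt.1 fun h => by
      have h1 := (dgt q (hne k hk q hq)).2 h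
      have h2 := Metric.infDist_le_dist_of_mem (x := w) hq
      simp only at hk'
      linarith
    exact ⟨q, hq, q', hq', h1, deq q (hne k hk q hq) h2, deq q' (hne k hk q' hq') h3⟩

/-! ### Sectors as convex cells -/

variable {R : Fin n → AxisRect}

/-- The slope of a vector. It is only used within open quadrants, where `z 0 ≠ 0`. -/
noncomputable def planeSlope (z : Plane) : ℝ := z 1 / z 0

lemma planeSlope_smul {m : ℝ} (hm : m ≠ 0) (z : Plane) : planeSlope (m • z) = planeSlope z := by
  simp [planeSlope, mul_div_mul_left _ _ hm]

lemma planeSlope_mem_uIcc {σ : Fin 2 → Bool} {x y z : Plane} (hx : x ∈ quadrant σ)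
    (hy : y ∈ quadrant σ) (hz : z ∈ segment ℝ x y) :
    planeSlope z ∈ uIcc (planeSlope x) (planeSlope y) := by
  have hz0 := (convex_quadrant σ).segment_subset hx hy hz 0
  obtain ⟨a, b, ha, hb, hab, rfl⟩ := hz
  have hx0 := hx 0
  have hy0 := hy 0
  simp only [PiLp.add_apply, PiLp.smul_apply, smul_eq_mul] at hz0
  rw [← segment_eq_uIcc]
  have hσ : boolSign (σ 0) ≠ 0 := fun h => by simp [h] at hx0
  have hxne : x 0 ≠ 0 := fun h => by simp [h] at hx0
  have hyne : y 0 ≠ 0 := fun h => by simp [h] at hy0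
  have hzne : a * x 0 + b * y 0 ≠ 0 := fun h => by simp [h] at hz0
  -- the slope is the mean of the slopes with weights proportional to `a * x 0` and `b * y 0`
  refine ⟨boolSign (σ 0) * (a * x 0) / (boolSign (σ 0) * (a * x 0 + b * y 0)),
    boolSign (σ 0) * (b * y 0) / (boolSign (σ 0) * (a * x 0 + b * y 0)), ?_, ?_, ?_, ?_⟩
  · exact div_nonneg (by nlinarith) hz0.le
  · exact div_nonneg (by nlinarith) hz0.le
  · field_simp
  · simp only [planeSlope, PiLp.add_apply, PiLp.smul_apply, smul_eq_mul]
    field_simp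

/-- The slopes of the directions from the corner `s.2` along which its region is cut. -/
def separatorSlopes (R : Fin n → AxisRect) (s : Σ i, cornerSets R i) : Set ℝ :=
  (fun w => planeSlope (w - s.2)) '' (tieSet R s.1 ∪ cutSet R s)

lemma cutSet_subset (s : Σ i, cornerSets R i) : cutSet R s ⊆ ⋃ j, tieSet R j := by
  rintro w ⟨h1, h2, ⟨j, hj, hj'⟩, h3⟩
  obtain ⟨q, hq, q', hq', hne, e, e'⟩ := h3 j hj hj'
  refine mem_iUnion.2 ⟨j, ⟨q, hq, q', hq', hne, e.trans hj'.symm, e'.trans hj'.symm⟩,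
    fun i => (h2 i).trans hj'.ge, s.1, hj.symm, ?_⟩
  rw [infDist_eq_of_nearest s.2.2 h1, hj']

lemma eq_of_mem_cutSet {s s' : Σ i, cornerSets R i} {w : Plane} (h : w ∈ cutSet R s)
    (h' : w ∈ cutSet R s') : s = s' := by
  obtain ⟨i, p⟩ := s
  obtain ⟨i', p'⟩ := s'
  have e := infDist_eq_of_nearest p.2 h.1
  have e' := infDist_eq_of_nearest p'.2 h'.1
  have hpp : dist w p = dist w (p' : Plane) :=
    le_antisymm (e ▸ h'.2.1 i) (e' ▸ h.2.1 i')
  obtain rfl : i = i' := by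
    by_contra hne
    -- the unique nearest corner of the second cluster contradicts the double tie
    obtain ⟨q, hq, q', hq', hqq, h1, h2⟩ := h.2.2.2 i' (Ne.symm hne) (e'.trans hpp.symm)
    by_cases hqp : q = p'
    · have := h'.1 q' hq' (fun h => hqq (hqp.trans h.symm))
      simp only at this h2
      linarith
    · have := h'.1 q hq hqp
      simp only at this h1
      linarith
  obtain rfl : p = p' := by
    by_contra hne
    have hne' : (p : Plane) ≠ p' := fun e => hne (Subtype.ext e)
    exact lt_asymm (h.1 p' p'.2 hne'.symm) (h'.1 p p.2 hne')
  rfl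

section Disjoint

variable (hR : Pairwise fun i j => Disjoint (R i).toSet (R j).toSet)
include hR

lemma finite_tieSet (j : Fin n) : (tieSet R j).Finite :=
  finite_of_encard_le_coe (k := 12) (encard_tieSet_le hR j)

lemma ncard_tieSet_le (j : Fin n) : (tieSet R j).ncard ≤ 12 := by
  have := encard_tieSet_le hR j
  rw [← (finite_tieSet hR j).cast_ncard_eq] at this
  exact_mod_cast this

lemma finite_cutSet (s : Σ i, cornerSets R i) : (cutSet R s).Finite :=
  (finite_iUnion (finite_tieSet hR)).subset (cutSet_subset s)

lemma finite_separatorSlopes (s : Σ i, cornerSets R i) : (separatorSlopes R s).Finite :=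
  ((finite_tieSet hR s.1).union (finite_cutSet hR s)).image _

lemma ncard_separatorSlopes_le (s : Σ i, cornerSets R i) :
    (separatorSlopes R s).ncard ≤ 12 + (cutSet R s).ncard :=
  (ncard_image_le ((finite_tieSet hR s.1).union (finite_cutSet hR s))).trans
    ((ncard_union_le _ _).trans (Nat.add_le_add_right (ncard_tieSet_le hR _) _))

end Disjoint

/-- Indices of cells: a corner, a quadrant at the corner, and the number of separating slopes below
the slopes of the sector. -/
abbrev CellIndex (R : Fin n → AxisRect) : Type :=
  Σ s : (Σ i, cornerSets R i), (Fin 2 → Bool) × Fin ((separatorSlopes R s).ncard + 1)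

/-- The part of a region within one quadrant at its corner and between two consecutive separating
slopes. -/
def sectorCell (R : Fin n → AxisRect) (c : CellIndex R) : Set Plane :=
  {x | x ∈ region (cornerSets R) c.1 ∧ x - c.1.2 ∈ quadrant c.2.1 ∧
    planeSlope (x - c.1.2) ∉ separatorSlopes R c.1 ∧
    (separatorSlopes R c.1 ∩ Iio (planeSlope (x - c.1.2))).ncard = c.2.2}

/-- Two numbers outside `S` with the same count of smaller elements of `S` have no element of `S`
between them. -/
lemma notMem_of_ncard_eq {S : Set ℝ} (hS : S.Finite) {a b : ℝ} (ha : a ∉ S) (hb : b ∉ S)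
    (h : (S ∩ Iio a).ncard = (S ∩ Iio b).ncard) {c : ℝ} (hc : c ∈ uIcc a b) :
    c ∉ S ∧ (S ∩ Iio c).ncard = (S ∩ Iio a).ncard := by
  wlog hab : a ≤ b generalizing a b
  · have := this hb ha h.symm (uIcc_comm a b ▸ hc) (le_of_not_ge hab)
    exact ⟨this.1, this.2.trans h.symm⟩
  rw [uIcc_of_le hab] at hc
  have hsub : ∀ {u v : ℝ}, u ≤ v → S ∩ Iio u ⊆ S ∩ Iio v := fun huv =>
    inter_subset_inter_right _ (Iio_subset_Iio huv)
  have heq : S ∩ Iio a = S ∩ Iio b :=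
    eq_of_subset_of_ncard_le (hsub hab) h.ge (hS.subset inter_subset_left)
  refine ⟨fun hcS => ?_, ?_⟩
  · have hcb : c ∈ S ∩ Iio b := ⟨hcS, hc.2.lt_of_ne (by rintro rfl; exact hb hcS)⟩
    rw [← heq] at hcb
    exact absurd hcb.2 (not_lt.2 hc.1)
  · rw [subset_antisymm ((hsub hc.2).trans heq.ge) (hsub hc.1)]

lemma convex_sectorCell (hR : Pairwise fun i j => Disjoint (R i).toSet (R j).toSet)
    (c : CellIndex R) : Convex ℝ (sectorCell R c) := by
  obtain ⟨s, σ, k⟩ := c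
  refine convex_iff_segment_subset.2 fun x hx y hy v hv => ?_
  obtain ⟨z₀, rfl⟩ : ∃ z, x = (s.2 : Plane) + z := ⟨x - s.2, by abel⟩
  obtain ⟨z₁, rfl⟩ : ∃ z, y = (s.2 : Plane) + z := ⟨y - s.2, by abel⟩
  obtain ⟨z, rfl⟩ : ∃ z, v = (s.2 : Plane) + z := ⟨v - s.2, by abel⟩
  simp only [sectorCell, mem_ofPred_eq, add_sub_cancel_left] at hx hy ⊢
  rw [← mem_preimage, segment_translate_preimage] at hv
  have hrank : ∀ z ∈ segment ℝ z₀ z₁, planeSlope z ∉ separatorSlopes R s ∧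
      (separatorSlopes R s ∩ Iio (planeSlope z)).ncard =
        (separatorSlopes R s ∩ Iio (planeSlope z₀)).ncard := fun z hz =>
    notMem_of_ncard_eq (finite_separatorSlopes hR s) hx.2.2.1 hy.2.2.1
      (hx.2.2.2.trans hy.2.2.2.symm) (planeSlope_mem_uIcc hx.2.1 hy.2.1 hz)
  refine ⟨?_, (convex_quadrant σ).segment_subset hx.2.1 hy.2.1 hv, (hrank z hv).1,
    (hrank z hv).2.trans hx.2.2.2⟩
  by_contra hzr
  obtain ⟨z', hz', m, hm, hsep⟩ := exists_separator hR hx.2.1 hy.2.1 hx.1 hy.1 hv hzr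
  refine (hrank z' hz').1 ⟨_, hsep, ?_⟩
  simp only [add_sub_cancel_left]
  exact planeSlope_smul (inv_pos.2 hm).ne' z'

lemma isOpen_sectorCell (hR : Pairwise fun i j => Disjoint (R i).toSet (R j).toSet)
    (c : CellIndex R) : IsOpen (sectorCell R c) := by
  rw [isOpen_iff_mem_nhds]
  rintro x ⟨h1, h2, h3, h4⟩
  have hx0 : (x - c.1.2) 0 ≠ 0 := fun h => by simpa [h] using h2 0
  have hcont : ContinuousAt (fun y : Plane => planeSlope (y - c.1.2)) x := by
    unfold planeSlope
    exact ContinuousAt.div (by fun_prop) (by fun_prop) hx0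
  have hev : ∀ᶠ τ in 𝓝 (planeSlope (x - c.1.2)), ∀ a ∈ separatorSlopes R c.1,
      a ≠ τ ∧ (a < τ ↔ a < planeSlope (x - c.1.2)) := by
    rw [eventually_all_finite (finite_separatorSlopes hR c.1)]
    intro a ha
    rcases lt_trichotomy a (planeSlope (x - c.1.2)) with h | h | h
    · filter_upwards [lt_mem_nhds h] with τ hτ
      exact ⟨hτ.ne, iff_of_true hτ h⟩
    · exact absurd (h ▸ ha) h3
    · filter_upwards [gt_mem_nhds h] with τ hτ
      exact ⟨hτ.ne', iff_of_false (not_lt.2 hτ.le) (not_lt.2 h.le)⟩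
  have hq : ∀ᶠ y in 𝓝 x, y - (c.1.2 : Plane) ∈ quadrant c.2.1 :=
    (continuousAt_id.sub continuousAt_const).eventually ((isOpen_quadrant _).mem_nhds h2)
  filter_upwards [(isOpen_region c.1).mem_nhds h1, hq, hcont.eventually hev] with y y1 y2 y3
  refine ⟨y1, y2, fun h => (y3 _ h).1 rfl, ?_⟩
  rw [← h4]
  congr 1
  ext a
  exact ⟨fun h => ⟨h.1, (y3 a h.1).2.1 h.2⟩, fun h => ⟨h.1, (y3 a h.1).2.2 h.2⟩⟩

lemma eq_of_mem_sectorCell {c c' : CellIndex R} {x : Plane} (h : x ∈ sectorCell R c)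
    (h' : x ∈ sectorCell R c') : c = c' := by
  obtain ⟨s, σ, k⟩ := c
  obtain ⟨s', σ', k'⟩ := c'
  obtain rfl : s = s' := eq_of_mem_region h.1 h'.1
  have hσ : σ = σ' := by
    funext m
    have h1 : 0 < boolSign (σ m) * (x - (s.2 : Plane)) m := h.2.1 m
    have h2 : 0 < boolSign (σ' m) * (x - (s.2 : Plane)) m := h'.2.1 m
    cases e : σ m <;> cases e' : σ' m <;> simp [e, e', boolSign] at h1 h2 ⊢ <;> linarith
  have hk : k = k' := Fin.ext (h.2.2.2.symm.trans h'.2.2.2)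
  rw [hσ, hk]

/-! ### The complement of the cells -/

/-- For all but finitely many slopes, every line of that slope meets `A` in finitely many
points. -/
def IsThin (A : Set Plane) : Prop :=
  ∃ B : Set ℝ, B.Finite ∧ ∀ τ ∉ B, ∀ x : Plane, {t : ℝ | x + t • !₂[1, τ] ∈ A}.Finite

lemma IsThin.mono {A A' : Set Plane} (h : IsThin A) (hA : A' ⊆ A) : IsThin A' := by
  obtain ⟨B, hB, h⟩ := h
  exact ⟨B, hB, fun τ hτ x => (h τ hτ x).subset fun t ht => hA ht⟩

lemma IsThin.biUnion {α : Type*} {I : Set α} (hI : I.Finite) {A : α → Set Plane}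
    (h : ∀ a ∈ I, IsThin (A a)) : IsThin (⋃ a ∈ I, A a) := by
  choose! B hB h using h
  refine ⟨⋃ a ∈ I, B a, hI.biUnion hB, fun τ hτ x => ?_⟩
  have : {t : ℝ | x + t • !₂[1, τ] ∈ ⋃ a ∈ I, A a} =
      ⋃ a ∈ I, {t : ℝ | x + t • !₂[1, τ] ∈ A a} := by
    ext t; simp
  rw [this]
  exact hI.biUnion fun a ha => h a ha τ (fun h' => hτ (mem_biUnion ha h')) x

lemma IsThin.union {A A' : Set Plane} (h : IsThin A) (h' : IsThin A') : IsThin (A ∪ A') := by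
  obtain ⟨B, hB, h⟩ := h
  obtain ⟨B', hB', h'⟩ := h'
  refine ⟨B ∪ B', hB.union hB', fun τ hτ x => ?_⟩
  exact ((h τ (fun e => hτ (Or.inl e)) x).union (h' τ (fun e => hτ (Or.inr e)) x)).subset
    fun t ht => ht

lemma isThin_line {a b c : ℝ} (h : a ≠ 0 ∨ b ≠ 0) : IsThin {x | a * x 0 + b * x 1 = c} := by
  refine ⟨{τ | a + b * τ = 0}, Set.Subsingleton.finite ?_, fun τ hτ x =>
    Set.Subsingleton.finite ?_⟩
  · intro τ hτ τ' hτ'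
    simp only [mem_ofPred_eq] at hτ hτ'
    have hb : b ≠ 0 := by
      rintro rfl
      simp at hτ h
      exact h hτ
    exact mul_left_cancel₀ hb (by linarith)
  · intro t ht t' ht'
    simp at ht ht'
    have hτ : a + b * τ ≠ 0 := hτ
    exact mul_right_cancel₀ hτ (by linarith)

lemma isThin_bisector {p q : Plane} (h : p ≠ q) : IsThin {x | dist x p = dist x q} := by
  refine (isThin_line (a := 2 * (q 0 - p 0)) (b := 2 * (q 1 - p 1))
    (c := q 0 ^ 2 + q 1 ^ 2 - p 0 ^ 2 - p 1 ^ 2) ?_).mono ?_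
  · by_contra! hc
    apply h
    ext k
    fin_cases k
    · simp; linarith [hc.1]
    · simp; linarith [hc.2]
  · intro x hx
    have := congrArg (· ^ 2) (show dist x p = dist x q from hx)
    simp only [Plane.dist_sq (zero_ne_one)] at this
    simp only [mem_ofPred_eq]
    linarith

/-- A point outside all regions is equidistant from two corners: its nearest corner in a farthest
cluster is tied with another corner. -/
lemma isThin_compl_regions [Nonempty (Fin n)]
    (hR : Pairwise fun i j => Disjoint (R i).toSet (R j).toSet) :
    IsThin {x | ∀ s, x ∉ region (cornerSets R) s} := by
  have hfin : (⋃ i, (R i).corners).Finite := finite_iUnion fun i => (R i).corners_finite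
  refine (IsThin.biUnion hfin (A := fun p => ⋃ q ∈ (⋃ i, (R i).corners) \ {p},
    {x | dist x p = dist x q}) fun p _ => IsThin.biUnion (hfin.subset sdiff_subset)
      fun q hq => isThin_bisector (Ne.symm hq.2)).mono ?_
  intro x hx
  obtain ⟨i, hi⟩ := Finite.exists_max fun i => Metric.infDist x (R i).corners
  obtain ⟨p, hp, hpd⟩ := (R i).exists_infDist_eq x
  have hx := hx ⟨i, p, hp⟩
  rw [mem_region_iff, not_and_or] at hx
  simp only [mem_iUnion, exists_prop, Set.mem_sdiff, mem_singleton_iff]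
  refine ⟨p, ⟨i, hp⟩, ?_⟩
  rcases hx with hx | hx
  · push Not at hx
    obtain ⟨q, hq, hqp, hle⟩ := hx
    exact ⟨q, ⟨⟨i, hq⟩, hqp⟩, le_antisymm (hpd ▸ Metric.infDist_le_dist_of_mem hq) hle⟩
  · push Not at hx
    obtain ⟨j, hj, hle⟩ := hx
    obtain ⟨q, hq, hqd⟩ := (R j).exists_infDist_eq x
    refine ⟨q, ⟨⟨j, hq⟩, AxisRect.ne_of_mem_corners (hR (Ne.symm hj)) hp hq⟩,
      le_antisymm (hle q hq) ?_⟩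
    exact hpd ▸ hqd ▸ hi j

lemma isThin_compl_sectorCells [Nonempty (Fin n)]
    (hR : Pairwise fun i j => Disjoint (R i).toSet (R j).toSet) :
    IsThin {x | ∀ c, x ∉ sectorCell R c} := by
  have hfin : Finite (Σ i, cornerSets R i) := by
    have : ∀ i, Finite (cornerSets R i) := fun i => (R i).corners_finite
    infer_instance
  refine ((isThin_compl_regions hR).union (IsThin.biUnion (finite_univ (α := Σ i, cornerSets R i))
    (A := fun s => ({x | 1 * x 0 + 0 * x 1 = (s.2 : Plane) 0} ∪
      {x | 0 * x 0 + 1 * x 1 = (s.2 : Plane) 1}) ∪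
      ⋃ τ ∈ separatorSlopes R s, {x | (-τ) * x 0 + 1 * x 1 = (s.2 : Plane) 1 - τ * (s.2 : Plane) 0})
      fun s _ => ((isThin_line (by simp)).union (isThin_line (by simp))).union
        (IsThin.biUnion (finite_separatorSlopes hR s) fun τ _ => isThin_line (by simp)))).mono ?_
  intro x hx
  by_cases hreg : ∀ s, x ∉ region (cornerSets R) s
  · exact Or.inl hreg
  push Not at hreg
  obtain ⟨s, hs⟩ := hreg
  refine Or.inr (mem_biUnion (mem_univ s) ?_)
  by_cases h0 : x 0 = (s.2 : Plane) 0
  · exact Or.inl (Or.inl (by simpa using h0))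
  by_cases h1 : x 1 = (s.2 : Plane) 1
  · exact Or.inl (Or.inr (by simpa using h1))
  right
  by_contra hτ
  have hne : ∀ k, x k - (s.2 : Plane) k ≠ 0 := by
    intro k
    fin_cases k
    exacts [sub_ne_zero.2 h0, sub_ne_zero.2 h1]
  refine hx ⟨s, fun k => decide (0 < x k - (s.2 : Plane) k),
    ⟨(separatorSlopes R s ∩ Iio (planeSlope (x - s.2))).ncard, Nat.lt_succ_of_le
      (ncard_le_ncard inter_subset_left (finite_separatorSlopes hR s))⟩⟩ ⟨hs, ?_, ?_, rfl⟩
  · intro k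
    by_cases h : 0 < x k - (s.2 : Plane) k
    · simp [boolSign, h]
    · have := lt_of_le_of_ne (not_lt.1 h) (hne k)
      simp [boolSign] at h this ⊢
      simp [not_lt.2 h, this]
  · intro hmem
    refine hτ (mem_biUnion hmem ?_)
    have hx0 : x 0 - (s.2 : Plane) 0 ≠ 0 := hne 0
    simp only [planeSlope, mem_ofPred_eq, PiLp.sub_apply]
    field_simp
    ring

lemma exists_subdivision [Nonempty (Fin n)]
    (hR : Pairwise fun i j => Disjoint (R i).toSet (R j).toSet) :
    ∃ T : ConvexSubdivision (CellIndex R) Plane, T.cell = sectorCell R := by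
  obtain ⟨B, hB, h⟩ := isThin_compl_sectorCells hR
  obtain ⟨τ, hτ⟩ := hB.infinite_compl.nonempty
  refine ⟨{ cell := sectorCell R
            isOpen := isOpen_sectorCell hR
            convex := convex_sectorCell hR
            eq_of_mem := eq_of_mem_sectorCell
            dir := !₂[1, τ]
            height := EuclideanSpace.proj 1 - τ • EuclideanSpace.proj 0
            height_dir := by simp
            exists_smul := fun x hx => ⟨x 0, ?_⟩
            finite_compl := h τ hτ }, rfl⟩
  simp at hx
  ext k
  fin_cases k
  · simp
  · simp; linarith

/-! ### Counting the cells -/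

lemma card_corners_le (i : Fin n) : Nat.card (cornerSets R i) ≤ 4 := by
  classical
  have hinj : Function.Injective fun (x : cornerSets R i) (k : Fin 2) =>
      decide (x.1 k = (R i).hi k) := by
    intro x y hxy
    apply Subtype.ext
    ext k
    have h := congrFun hxy k
    simp only [decide_eq_decide] at h
    by_cases hk : x.1 k = (R i).hi k
    · rw [hk, h.1 hk]
    · rw [(x.2 k).resolve_right hk, (y.2 k).resolve_right fun e => hk (h.2 e)]
  simpa using Nat.card_le_card_of_injective _ hinj

theorem card_cellIndex_le (hR : Pairwise fun i j => Disjoint (R i).toSet (R j).toSet) :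
    Nat.card (CellIndex R) ≤ 256 * n := by
  classical
  have hfin : ∀ i, Finite (cornerSets R i) := fun i => (R i).corners_finite
  have := Fintype.ofFinite (Σ i, cornerSets R i)
  have hcut : ∀ s, Finite (cutSet R s) := fun s => finite_cutSet hR s
  have htie : ∀ j, Finite (tieSet R j) := fun j => finite_tieSet hR j
  have h1 : Nat.card (Σ i, cornerSets R i) ≤ 4 * n := by
    rw [Nat.card_sigma]
    calc _ ≤ ∑ _ : Fin n, 4 := Finset.sum_le_sum fun i _ => card_corners_le i
      _ = 4 * n := by simp [mul_comm]
  -- a point of a cut set determines its corner, so all cut sets together inject into the tie sets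
  have h2 : Nat.card (Σ s, cutSet R s) ≤ 12 * n := by
    choose f hf using fun x : Σ s, cutSet R s => mem_iUnion.1 (cutSet_subset x.1 x.2.2)
    have hinj : Function.Injective fun x : Σ s, cutSet R s =>
        (⟨f x, x.2, hf x⟩ : Σ j, tieSet R j) := by
      rintro ⟨s, w, hw⟩ ⟨s', w', hw'⟩ h
      have hww : w = w' := by
        have := congrArg (fun y : Σ j, tieSet R j => (y.2 : Plane)) h
        simpa using this
      subst hww
      obtain rfl := eq_of_mem_cutSet hw hw'
      rfl
    refine (Nat.card_le_card_of_injective _ hinj).trans ?_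
    rw [Nat.card_sigma]
    calc _ ≤ ∑ _ : Fin n, 12 := Finset.sum_le_sum fun j _ => ncard_tieSet_le hR j
      _ = 12 * n := by simp [mul_comm]
  rw [Nat.card_sigma] at h2 ⊢
  rw [Nat.card_eq_fintype_card] at h1
  calc _ ≤ ∑ s : Σ i, cornerSets R i, (4 * 13 + 4 * Nat.card (cutSet R s)) := by
        refine Finset.sum_le_sum fun s _ => ?_
        have := ncard_separatorSlopes_le hR s
        rw [Nat.card_prod]
        simp only [Nat.card_eq_fintype_card, Fintype.card_pi, Fintype.card_bool, Fintype.card_fin,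
          Finset.prod_const, Finset.card_univ]
        rw [← Nat.card_coe_set_eq (cutSet R s)] at this
        omega
    _ = 52 * Fintype.card (Σ i, cornerSets R i) + 4 * ∑ s, Nat.card (cutSet R s) := by
        rw [Finset.sum_add_distrib, Finset.mul_sum]
        simp [mul_comm]
    _ ≤ 256 * n := by omega

theorem mainTheorem5 :
    ∃ C : ℕ, ∀ (n : ℕ) (R : Fin n → AxisRect),
      Pairwise (fun i j => Disjoint (R i).toSet (R j).toSet) →
        FCVD.complexity (fun i => (R i).corners) ≤ (C : ℕ∞) * (n : ℕ∞) := by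
  -- nine times the bound on the number of cells
  refine ⟨2304, fun n R hR => ?_⟩
  have hcard : (Nat.card (CellIndex R) : ℕ∞) ≤ 256 * n := by
    exact_mod_cast card_cellIndex_le hR
  have hfin : ∀ i, Finite (cornerSets R i) := fun i => (R i).corners_finite
  rcases isEmpty_or_nonempty (Fin n) with hn | hn
  · have hempty : IsEmpty (Σ i, cornerSets R i) := inferInstance
    have h1 : (vertices (cornerSets R)) = ∅ := by
      ext x
      have : {s | x ∈ closure (region (cornerSets R) s)} = ∅ := eq_empty_of_isEmpty _
      simp only [vertices, mem_ofPred_eq, this, encard_empty]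
      simp
    have h2 : faces (cornerSets R) = ∅ := by
      simp [faces, components]
    have h3 : edges (cornerSets R) = ∅ := by
      simp [edges, skeleton, components]
    change complexity (cornerSets R) ≤ _
    simp [complexity, h1, h2, h3]
  · obtain ⟨T, hT⟩ := exists_subdivision hR
    have href : Refines T (cornerSets R) fun c => c.1 :=
      { subset := fun c => by rw [hT]; exact fun x hx => hx.1
        isOpen := isOpen_region
        eq_of_mem := eq_of_mem_region
        interior_closure := interior_closure_region_subset hR }
    calc complexity (cornerSets R) ≤ 9 * (Nat.card (CellIndex R) : ℕ∞) := href.complexity_le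
      _ ≤ 9 * (256 * n) := by gcongr
      _ = ((2304 : ℕ) : ℕ∞) * n := by rw [← mul_assoc]; norm_num
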